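/- Consider drone base stations (DBSs) in a plane with origin $\mathbf{o}'$ (the projection of the typical user). Their initial positions $\mathbf{x}_1,\mathbf{x}_2,\dots$ form a homogeneous Poisson point process (PPP) of density $\lambda_0>0$. In the different speed model (DSM), DBS $i$ moves along a straight line with constant speed $V_i$ in direction $\Theta_i$, so that its position at time $t$ is $\mathbf{x}_i+tV_i(\cos\Theta_i,\sin\Theta_i)$; the $\Theta_i$ are uniform on $[0,2\pi)$, the $V_i$ are non-negative with common cdf $F_V$ and pdf $f_V$, and all the speeds and directions are independent of each other and of the initial positions. Let $u^*$ be the distance from $\mathbf{o}'$ to the DBS that is closest to $\mathbf{o}'$ at time $0$ (the serving DBS), and let $\Phi_{\rm D}'(t)$ be the point process of the positions at time $t$ of all the other (non-serving) DBSs. Then, conditionally on $u^*$, $\Phi_{\rm D}'(0)$ is an inhomogeneous PPP whose density at distance $u$ from $\mathbf{o}'$ is $\lambda_0$ if $u>u^*$ and $0$ if $u\le u^*$; and for every $t>0$, conditionally on $u^*$, $\Phi_{\rm D}'(t)$ is an inhomogeneous PPP whose density at distance $u$ from $\mathbf{o}'$ is the non-negative function $$\lambda(t;u,u^*)=\lambda_0\left[1-F_V\!\left(\frac{u^*-u}{t}\right)-\int_{|u^*-u|/t}^{(u^*+u)/t}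 f_V(v)\,\frac1\pi\arccos\!\left(\frac{v^2t^2+u^2-{u^*}^2}{2vtu}\right)dv\right].$$ -/

import Mathlib

open MeasureTheory ProbabilityTheory Set
open scoped ENNReal NNReal

noncomputable section

namespace DroneNetwork

/-- `N` is, under `P`, a Poisson point process with intensity measure `Λ`: a random measure such
that the masses of disjoint bounded Borel sets `B j` are independent Poisson variables with the
(finite) means `Λ (B j)`. -/
structure IsPoissonProcess {Ω E : Type*} [MeasurableSpace Ω] [PseudoMetricSpace E]
    [MeasurableSpace E] (P : Measure Ω) (N : Ω → Measure E) (Λ : Measure E) : Prop where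
  measurable_count : ∀ B : Set E, MeasurableSet B → Measurable fun ω => N ω B
  finite_of_bounded : ∀ B : Set E, Bornology.IsBounded B → Λ B < ∞
  law_counts : ∀ (k : ℕ) (B : Fin k → Set E),
    (∀ j, MeasurableSet (B j)) → (∀ j, Bornology.IsBounded (B j)) →
    (Pairwise fun j l => Disjoint (B j) (B l)) → ∀ n : Fin k → ℕ,
    P {ω | ∀ j, N ω (B j) = (n j : ℝ≥0∞)} = ∏ j, poissonMeasure (Λ (B j)).toNNReal {n j}

/-- Conditionally on the real random variable `R`, `N` is a Poisson point process whose intensity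
measure on the event `R = r` is `Λ r`.  The conditional law of the counts given `R` is expressed
by integrating over the events `R ∈ A`, for `A` Borel. -/
structure IsPoissonProcessGiven {Ω E : Type*} [MeasurableSpace Ω] [PseudoMetricSpace E]
    [MeasurableSpace E] (P : Measure Ω) (N : Ω → Measure E) (R : Ω → ℝ) (Λ : ℝ → Measure E) :
    Prop where
  measurable_given : Measurable R
  measurable_count : ∀ B : Set E, MeasurableSet B → Measurable fun ω => N ω B
  finite_of_bounded : ∀ᵐ r ∂(P.map R), ∀ B : Set E, Bornology.IsBounded B → Λ r B < ∞
  law_counts : ∀ (k : ℕ) (B : Fin k → Set E),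
    (∀ j, MeasurableSet (B j)) → (∀ j, Bornology.IsBounded (B j)) →
    (Pairwise fun j l => Disjoint (B j) (B l)) → ∀ n : Fin k → ℕ,
    ∀ A : Set ℝ, MeasurableSet A →
    P {ω | R ω ∈ A ∧ ∀ j, N ω (B j) = (n j : ℝ≥0∞)} =
      ∫⁻ r in A, ∏ j, poissonMeasure (Λ r (B j)).toNNReal {n j} ∂(P.map R)

/-- The plane that contains the drones; its origin is the projection of the typical user. -/
abbrev Plane : Type := EuclideanSpace ℝ (Fin 2)

/-- The different speed model.  Drone `i` starts at `X i` and moves with constant speed `V i` in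
direction `Θ i`.  The initial positions form a homogeneous Poisson point process of density `lam`;
the speeds have the common law `ν`, the directions are uniform on `[0, 2π)`, and all of the speeds
and directions are independent of each other and of the initial positions. -/
structure IsDSM {Ω : Type*} [MeasurableSpace Ω] (P : Measure Ω) (lam : ℝ) (ν : Measure ℝ)
    (X : ℕ → Ω → Plane) (V Θ : ℕ → Ω → ℝ) : Prop where
  measurable_start : ∀ i, Measurable (X i)
  measurable_speed : ∀ i, Measurable (V i)
  measurable_direction : ∀ i, Measurable (Θ i)
  poisson_start :
    IsPoissonProcess P (fun ω => Measure.sum fun i => Measure.dirac (X i ω))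
      (ENNReal.ofReal lam • volume)
  law_speed : ∀ i, P.map (V i) = ν
  law_direction : ∀ i, pdf.IsUniform (Θ i) (Ico 0 (2 * Real.pi)) P volume
  indep_speed_direction : ∀ i, IndepFun (V i) (Θ i) P
  indep_drones : iIndepFun (fun i ω => (V i ω, Θ i ω)) P
  indep_start : IndepFun (fun ω i => X i ω) (fun ω i => (V i ω, Θ i ω)) P

/-- The position of drone `i` at time `t`. -/
def position {Ω : Type*} (X : ℕ → Ω → Plane) (V Θ : ℕ → Ω → ℝ) (t : ℝ) (i : ℕ) (ω : Ω) : Plane :=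
  X i ω + (t * V i ω) • !₂[Real.cos (Θ i ω), Real.sin (Θ i ω)]

/-- The distance `u*` from the origin to the initially closest drone. -/
def servingDistance {Ω : Type*} (X : ℕ → Ω → Plane) (ω : Ω) : ℝ := ⨅ i, ‖X i ω‖

/-- The non-serving drones: those that are not the closest one to the origin at time `0`. -/
def nonServing {Ω : Type*} (X : ℕ → Ω → Plane) (ω : Ω) : Set ℕ :=
  {i | ¬ ∀ j, ‖X i ω‖ ≤ ‖X j ω‖}

/-- The point process of the positions at time `t` of the non-serving drones. -/
def nonServingProcess {Ω : Type*} (X : ℕ → Ω → Plane) (V Θ : ℕ → Ω → ℝ) (t : ℝ) (ω : Ω) :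
    Measure Plane :=
  Measure.sum fun i : nonServing X ω => Measure.dirac (position X V Θ t i ω)

/-- The density at distance `u` from the origin of the non-serving drones at time `0`, when the
serving drone is at distance `s`. -/
def initialDensity (lam u s : ℝ) : ℝ := if s < u then lam else 0

/-- The density at distance `u` from the origin of the non-serving drones at time `t`, when the
serving drone started at distance `s`; `F` and `f` are the cdf and the pdf of the speed. -/
def density (lam : ℝ) (F f : ℝ → ℝ) (t u s : ℝ) : ℝ :=
  lam * (1 - F ((s - u) / t) -
    ∫ v in (|s - u| / t)..((s + u) / t),
      f v * (1 / Real.pi) *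
        Real.arccos ((v ^ 2 * t ^ 2 + u ^ 2 - s ^ 2) / (2 * v * t * u)))

/-- The measure on the plane with radial density `g`. -/
def radialMeasure (g : ℝ → ℝ) : Measure Plane :=
  volume.withDensity fun y => ENNReal.ofReal (g ‖y‖)

end DroneNetwork

end

open DroneNetwork

/-! The proof works with Laplace functionals. For a Poisson process of intensity Λ, E exp(-∑ φ(x_i))
= exp(-∫ (1 - e^{-φ}) dΛ) (`IsPoissonProcess.laplace`). Test functions take values in [0, ∞], so
that e^{-∞} = 0 can encode the emptiness of a disk. Conversely, Laplace transforms at natural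
exponents determine the joint law of finitely many counts (`ext_of_lintegral_expNeg`).

Conditioning on the serving distance R = r is conditioning on a null event, so the two sides are
compared as measures in R. On {x < R ≤ y} the points beyond y are independent of the event, and
their Laplace functional factorises. They differ from the non-serving points only if the annulus
between x and y holds two points, which has probability O((y - x)²). Replacing the factor at y by
its value at R costs the same order. Over a fine partition the errors vanish
(`setLIntegral_expNeg_nonServing`).

The displacements D are i.i.d. and independent of the starting points, which alone decide who
serves. Averaging over D replaces φ by ψ with e^{-ψ(x)} = E e^{-φ(x+D)}. Since 1 - e^{-ψ} is then
the average of 1 - e^{-φ(x+D)}, the functional is again Poisson, with the truncated intensity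
convolved with the law of D (`isPoissonProcessGiven_displaced`).

The density of that convolution at y is λ₀ P(‖y - D‖ > s). Given the speed, the law of cosines turns
the event into cos(Θ - φ) < c, of probability 1 - arccos(c)/π. Integrating over the speed, with c ≤
-1, c in between and c ≥ 1 separated, gives the formula. Nonnegativity follows from this
probabilistic form. -/

noncomputable section

namespace DroneNetwork

open Filter Topology

/-! ### The exponential on [0, ∞] -/

/-- The function `x ↦ e⁻ˣ` on `[0, ∞]`, with `e^{-∞} = 0`. -/
def expNeg (x : ℝ≥0∞) : ℝ≥0∞ := EReal.exp (-(x : EReal))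

lemma expNeg_zero : expNeg 0 = 1 := by simp [expNeg]

lemma expNeg_top : expNeg ∞ = 0 := by simp [expNeg]

lemma expNeg_ofReal {x : ℝ} (hx : 0 ≤ x) :
    expNeg (ENNReal.ofReal x) = ENNReal.ofReal (Real.exp (-x)) := by
  simp [expNeg, EReal.coe_ennreal_ofReal, hx, ← EReal.coe_neg]

lemma expNeg_coe (x : ℝ≥0) : expNeg x = ENNReal.ofReal (Real.exp (-x)) := by
  rw [← expNeg_ofReal x.coe_nonneg, ENNReal.ofReal_coe_nnreal]

lemma expNeg_add (x y : ℝ≥0∞) : expNeg (x + y) = expNeg x * expNeg y := by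
  simp only [expNeg, EReal.coe_ennreal_add, EReal.exp_neg, EReal.exp_add]
  have h : ∀ z : ℝ≥0∞, EReal.exp (z : EReal) ≠ 0 := fun z => by simp
  rw [ENNReal.mul_inv (Or.inl (h x)) (Or.inr (h y))]

lemma continuous_expNeg : Continuous expNeg :=
  ENNReal.continuous_exp.comp (continuous_neg.comp continuous_coe_ennreal_ereal)

lemma measurable_expNeg : Measurable expNeg := continuous_expNeg.measurable

lemma expNeg_antitone : Antitone expNeg := fun _ _ h =>
  EReal.exp_monotone (EReal.neg_le_neg_iff.2 (EReal.coe_ennreal_le_coe_ennreal_iff.2 h))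

lemma expNeg_injective : Function.Injective expNeg := fun x y h => by
  have := EReal.exp_strictMono.injective h
  simpa using this

lemma expNeg_le_one (x : ℝ≥0∞) : expNeg x ≤ 1 := by
  simpa [expNeg_zero] using expNeg_antitone (zero_le (a := x))

lemma expNeg_ne_top (x : ℝ≥0∞) : expNeg x ≠ ∞ :=
  ne_top_of_le_ne_top ENNReal.one_ne_top (expNeg_le_one x)

lemma expNeg_sum {ι : Type*} (s : Finset ι) (a : ι → ℝ≥0∞) :
    expNeg (∑ i ∈ s, a i) = ∏ i ∈ s, expNeg (a i) := by
  classical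
  induction s using Finset.induction_on with
  | empty => simp [expNeg_zero]
  | insert i s hi ih => rw [Finset.sum_insert hi, Finset.prod_insert hi, expNeg_add, ih]

lemma expNeg_nat_mul (n : ℕ) (x : ℝ≥0∞) : expNeg (n * x) = expNeg x ^ n := by
  have := expNeg_sum (Finset.range n) (fun _ => x)
  simpa using this

lemma one_sub_expNeg_le (x : ℝ≥0∞) : 1 - expNeg x ≤ x := by
  induction x with
  | top => simp
  | coe x =>
    rw [expNeg_coe, ← ENNReal.ofReal_one, ← ENNReal.ofReal_sub _ (Real.exp_pos _).le,
      ← ENNReal.ofReal_coe_nnreal]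
    apply ENNReal.ofReal_le_ofReal
    have := Real.add_one_le_exp (-(x : ℝ))
    linarith

/-- The function is 1-Lipschitz, in additive form to avoid truncated subtraction. It turns a small
change of intensity into an error linear in that change. -/
lemma expNeg_le_expNeg_add (s d : ℝ≥0∞) : expNeg s ≤ expNeg (s + d) + d := by
  have h : 1 ≤ expNeg d + d := by
    have := one_sub_expNeg_le d
    rwa [tsub_le_iff_left] at this
  calc expNeg s = expNeg s * 1 := (mul_one _).symm
    _ ≤ expNeg s * (expNeg d + d) := by gcongr
    _ = expNeg (s + d) + expNeg s * d := by rw [mul_add, expNeg_add]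
    _ ≤ expNeg (s + d) + 1 * d := by gcongr; exact expNeg_le_one s
    _ = _ := by rw [one_mul]

/-- The inverse of `expNeg` on `[0, 1]`. -/
def negLog (x : ℝ≥0∞) : ℝ≥0∞ := (-ENNReal.log x).toENNReal

lemma expNeg_negLog {x : ℝ≥0∞} (hx : x ≤ 1) : expNeg (negLog x) = x := by
  have h : 0 ≤ -ENNReal.log x := by
    rw [EReal.neg_nonneg]
    have := ENNReal.log_monotone hx
    simpa using this
  rw [expNeg, negLog, EReal.coe_toENNReal h, neg_neg, ENNReal.exp_log]

lemma measurable_negLog : Measurable negLog :=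
  (ENNReal.measurable_log.neg).ereal_toENNReal

/-! ### Laplace transforms of independent sums, and discrete laws -/

lemma tendsto_expNeg_sum_range (a : ℕ → ℝ≥0∞) :
    Tendsto (fun n => ∏ i ∈ Finset.range n, expNeg (a i)) atTop (𝓝 (expNeg (∑' i, a i))) := by
  simp_rw [← expNeg_sum]
  exact (continuous_expNeg.tendsto _).comp ENNReal.summable.hasSum.tendsto_sum_nat

/-- The Laplace transform of a sum of independent random variables is the product of the Laplace
transforms. -/
lemma lintegral_expNeg_tsum {Ω : Type*} [MeasurableSpace Ω] {P : Measure Ω} [IsProbabilityMeasure P]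
    {Z : ℕ → Ω → ℝ≥0∞} (hZ : ∀ i, Measurable (Z i)) (hind : iIndepFun Z P) (b : ℕ → ℝ≥0∞)
    (hb : ∀ i, ∫⁻ ω, expNeg (Z i ω) ∂P = expNeg (b i)) :
    ∫⁻ ω, expNeg (∑' i, Z i ω) ∂P = expNeg (∑' i, b i) := by
  refine tendsto_nhds_unique ?_ (tendsto_expNeg_sum_range b)
  have hprod : ∀ n : ℕ, ∏ i ∈ Finset.range n, expNeg (b i) =
      ∫⁻ ω, ∏ i ∈ Finset.range n, expNeg (Z i ω) ∂P := fun n => by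
    have h1 : iIndepFun (fun (i : Finset.range n) ω => expNeg (Z i ω)) P :=
      (hind.precomp (g := fun i : Finset.range n => (i : ℕ)) Subtype.val_injective).comp
        (fun _ => expNeg) (fun _ => measurable_expNeg)
    have h2 := lintegral_prod_eq_prod_lintegral_of_indepFun (μ := P) Finset.univ
      (fun (i : Finset.range n) ω => expNeg (Z i ω)) h1 (fun i => measurable_expNeg.comp (hZ i))
    simp_rw [hb] at h2
    rw [← Finset.prod_coe_sort, ← h2]
    exact lintegral_congr fun ω => Finset.prod_coe_sort (Finset.range n) (fun i => expNeg (Z i ω))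
  simp_rw [hprod]
  refine tendsto_lintegral_of_dominated_convergence (fun _ => 1) ?_ ?_ (by simp) ?_
  · exact fun n => Finset.measurable_prod _ fun i _ => measurable_expNeg.comp (hZ i)
  · exact fun n => ae_of_all _ fun ω => Finset.prod_le_one' fun i _ => expNeg_le_one _
  · exact ae_of_all _ fun ω => tendsto_expNeg_sum_range _

lemma lintegral_pi_prod {k : ℕ} {E : Type*} [MeasurableSpace E] (μ : Fin k → Measure E)
    [∀ j, IsProbabilityMeasure (μ j)] {f : Fin k → E → ℝ≥0∞} (hf : ∀ j, Measurable (f j)) :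
    ∫⁻ x, ∏ j, f j (x j) ∂(Measure.pi μ) = ∏ j, ∫⁻ x, f j x ∂(μ j) := by
  have h := lintegral_prod_eq_prod_lintegral_of_indepFun (μ := Measure.pi μ) Finset.univ
    (fun j (x : Fin k → E) => f j (x j)) (iIndepFun_pi fun j => (hf j).aemeasurable)
    (fun j => (hf j).comp (measurable_pi_apply j))
  rw [h]
  refine Finset.prod_congr rfl fun j _ => ?_
  exact (measurePreserving_eval μ j).lintegral_comp (hf j)

/-- The probability generating function of the Poisson distribution. -/
lemma lintegral_poissonMeasure_pow (r : ℝ≥0) (x : ℝ≥0∞) (hx : x ≤ 1) :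
    ∫⁻ n, x ^ n ∂(poissonMeasure r) = expNeg ((1 - x) * r) := by
  lift x to ℝ≥0 using ne_top_of_le_ne_top ENNReal.one_ne_top hx
  have hx' : x ≤ 1 := by exact_mod_cast hx
  have h1 : ((1 : ℝ≥0∞) - x) * r = ((1 - x) * r : ℝ≥0) := by push_cast; rfl
  rw [h1, expNeg_coe, poissonMeasure, lintegral_sum_measure]
  simp_rw [lintegral_smul_measure, lintegral_dirac, smul_eq_mul]
  have hs : HasSum (fun n : ℕ => Real.exp (-r) * r ^ n / (n.factorial : ℝ) * (x : ℝ) ^ n)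
      (Real.exp (-(((1 - x) * r : ℝ≥0) : ℝ))) := by
    have := (NormedSpace.expSeries_div_hasSum_exp ((r : ℝ) * x)).mul_left (Real.exp (-(r : ℝ)))
    rw [← Real.exp_eq_exp_ℝ, ← Real.exp_add] at this
    have e : -(r : ℝ) + r * x = -(((1 - x) * r : ℝ≥0) : ℝ) := by
      push_cast [NNReal.coe_sub hx']
      ring
    rw [e] at this
    refine this.congr_fun fun n => ?_
    rw [mul_pow]; ring
  rw [← hs.tsum_eq, ENNReal.ofReal_tsum_of_nonneg (fun n => by positivity) hs.summable]
  refine tsum_congr fun n => ?_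
  rw [ENNReal.ofReal_mul (by positivity), ENNReal.ofReal_pow (by positivity),
    ENNReal.ofReal_coe_nnreal]

/-- A probability measure whose atoms are those of the image of a discrete probability measure
under an injective map is that image. -/
lemma eq_map_of_forall_singleton {ι E : Type*} [MeasurableSpace ι] [Countable ι]
    [MeasurableSingletonClass ι] [MeasurableSpace E] [MeasurableSingletonClass E]
    {μ : Measure E} {m : Measure ι} [IsProbabilityMeasure μ] [IsProbabilityMeasure m] {c : ι → E}
    (hc : Function.Injective c) (h : ∀ i, μ {c i} = m {i}) : μ = m.map c := by
  have hcm : Measurable c := measurable_of_countable c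
  have : IsProbabilityMeasure (m.map c) := Measure.isProbabilityMeasure_map hcm.aemeasurable
  symm
  -- Both total masses are 1, so one inequality suffices: no mass of `μ` is left off the atoms.
  refine Measure.eq_of_le_of_measure_univ_eq ?_ (by simp)
  rw [Measure.le_iff]
  intro S hS
  rw [Measure.map_apply hcm hS]
  have hcount : (c ⁻¹' S).Countable := to_countable _
  calc m (c ⁻¹' S) = ∑' i : c ⁻¹' S, m {(i : ι)} := by
        conv_lhs => rw [← biUnion_of_singleton (c ⁻¹' S)]
        exact measure_biUnion hcount
          (fun i _ j _ hij => by simpa using hij)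
          (fun _ _ => measurableSet_singleton _)
    _ = ∑' i : c ⁻¹' S, μ {c i} := by simp_rw [h]
    _ = μ (⋃ i ∈ c ⁻¹' S, {c i}) := by
        refine (measure_biUnion hcount (fun i _ j _ hij => ?_)
          (fun _ _ => measurableSet_singleton _)).symm
        simpa using fun hh => hij (hc hh)
    _ ≤ μ S := measure_mono (by simp)

/-- Level sets of a simple function form a finite disjoint family; indexing them by `Fin` matches
the shape of `law_counts`. -/
lemma setLIntegral_comp_simpleFunc {E : Type*} [MeasurableSpace E] (μ : Measure E)
    (s : SimpleFunc E ℝ≥0∞) (g : ℝ≥0∞ → ℝ≥0∞)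
    {B : Set E} (hB : MeasurableSet B) :
    ∫⁻ x in B, g (s x) ∂μ =
      ∑ j : Fin s.range.card, g (s.range.equivFin.symm j) *
        μ (s ⁻¹' {(s.range.equivFin.symm j : ℝ≥0∞)} ∩ B) := by
  have h1 : ∫⁻ x in B, g (s x) ∂μ = (s.map g).lintegral (μ.restrict B) := by
    rw [← SimpleFunc.lintegral_eq_lintegral]; rfl
  rw [h1, SimpleFunc.map_lintegral, ← Finset.sum_coe_sort,
    ← Equiv.sum_comp s.range.equivFin.symm]
  refine Finset.sum_congr rfl fun j _ => ?_
  rw [Measure.restrict_apply' hB]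

/-! ### The Laplace functional of a Poisson process -/

section Poisson

variable {Ω E : Type*} [MeasurableSpace Ω] [PseudoMetricSpace E] [MeasurableSpace E]
  {P : Measure Ω} [IsProbabilityMeasure P] {N : Ω → Measure E} {Λ : Measure E}

/-- The joint law of the counts of a Poisson process is a product of Poisson laws. -/
lemma IsPoissonProcess.map_counts (hN : IsPoissonProcess P N Λ) {k : ℕ} {B : Fin k → Set E}
    (hB : ∀ j, MeasurableSet (B j)) (hb : ∀ j, Bornology.IsBounded (B j))
    (hd : Pairwise fun j l => Disjoint (B j) (B l)) :
    P.map (fun ω j => N ω (B j)) =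
      (Measure.pi fun j => poissonMeasure (Λ (B j)).toNNReal).map fun n j => (n j : ℝ≥0∞) := by
  have hT : Measurable fun ω j => N ω (B j) :=
    measurable_pi_lambda _ fun j => hN.measurable_count _ (hB j)
  have : IsProbabilityMeasure (P.map fun ω j => N ω (B j)) :=
    Measure.isProbabilityMeasure_map hT.aemeasurable
  refine eq_map_of_forall_singleton (fun n m h => ?_) fun n => ?_
  · ext j
    exact_mod_cast congrFun h j
  · rw [Measure.map_apply hT (measurableSet_singleton _), Measure.pi_singleton,
      ← hN.law_counts k B hB hb hd n]
    congr 1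
    ext ω
    simp [funext_iff]

/-- `law_counts` never mentions the value ∞, but the Poisson probabilities already sum to 1, so the
law of the count is carried by ℕ. -/
lemma IsPoissonProcess.ae_lt_top (hN : IsPoissonProcess P N Λ) {B : Set E} (hB : MeasurableSet B)
    (hb : Bornology.IsBounded B) : ∀ᵐ ω ∂P, N ω B < ∞ := by
  have h := hN.map_counts (k := 1) (B := fun _ => B) (fun _ => hB) (fun _ => hb)
    (fun i j hij => absurd (Subsingleton.elim i j) hij)
  have hT : Measurable fun ω (_ : Fin 1) => N ω B :=
    measurable_pi_lambda _ fun j => hN.measurable_count _ hB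
  have hS : MeasurableSet {x : Fin 1 → ℝ≥0∞ | x 0 < ∞} :=
    measurableSet_lt (measurable_pi_apply 0) measurable_const
  have h2 : ∀ᵐ x ∂(P.map fun ω (_ : Fin 1) => N ω B), x 0 < ∞ := by
    rw [h, ae_map_iff (measurable_of_countable _).aemeasurable hS]
    exact ae_of_all _ fun n => by simp
  exact (ae_map_iff hT.aemeasurable hS).1 h2

/-- Independence factorises the expectation, and each factor is the Poisson generating function at
e^{-c_j}. -/
lemma IsPoissonProcess.lintegral_prod_counts (hN : IsPoissonProcess P N Λ) {k : ℕ}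
    {B : Fin k → Set E}
    (hB : ∀ j, MeasurableSet (B j)) (hb : ∀ j, Bornology.IsBounded (B j))
    (hd : Pairwise fun j l => Disjoint (B j) (B l)) (c : Fin k → ℝ≥0∞) :
    ∫⁻ ω, expNeg (∑ j, c j * N ω (B j)) ∂P = expNeg (∑ j, (1 - expNeg (c j)) * Λ (B j)) := by
  have hT : Measurable fun ω j => N ω (B j) :=
    measurable_pi_lambda _ fun j => hN.measurable_count _ (hB j)
  have hm : Measurable fun x : Fin k → ℝ≥0∞ => expNeg (∑ j, c j * x j) :=
    measurable_expNeg.comp (Finset.measurable_sum _ fun j _ =>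
      (measurable_pi_apply j).const_mul _)
  have h1 := lintegral_map (μ := P) hm hT
  rw [← h1, hN.map_counts hB hb hd, lintegral_map hm (measurable_of_countable _)]
  have h2 : ∀ n : Fin k → ℕ, expNeg (∑ j, c j * (n j : ℝ≥0∞)) = ∏ j, expNeg (c j) ^ n j := by
    intro n
    rw [expNeg_sum]
    refine Finset.prod_congr rfl fun j _ => ?_
    rw [mul_comm, expNeg_nat_mul]
  simp_rw [h2]
  rw [lintegral_pi_prod _ (f := fun j n => expNeg (c j) ^ n) (fun _ => measurable_of_countable _),
    expNeg_sum]
  refine Finset.prod_congr rfl fun j _ => ?_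
  rw [lintegral_poissonMeasure_pow _ _ (expNeg_le_one _),
    ENNReal.coe_toNNReal (hN.finite_of_bounded _ (hb j)).ne]

lemma IsPoissonProcess.laplace_simpleFunc (hN : IsPoissonProcess P N Λ) (s : SimpleFunc E ℝ≥0∞)
    {B : Set E} (hB : MeasurableSet B) (hb : Bornology.IsBounded B) :
    ∫⁻ ω, expNeg (∫⁻ x in B, s x ∂(N ω)) ∂P = expNeg (∫⁻ x in B, (1 - expNeg (s x)) ∂Λ) := by
  rw [setLIntegral_comp_simpleFunc Λ s (fun c => 1 - expNeg c) hB]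
  have h1 := fun ω => setLIntegral_comp_simpleFunc (N ω) s (fun c => c) hB
  simp_rw [h1]
  refine hN.lintegral_prod_counts (fun j => (s.measurableSet_preimage _).inter hB)
    (fun j => hb.subset inter_subset_right) (fun j l hjl => ?_) _
  refine Disjoint.mono inter_subset_left inter_subset_left (Disjoint.preimage _ ?_)
  simpa [Subtype.val_inj] using hjl

/-- Counts are controlled only on bounded sets, so the simple approximation and the ball grow
together and monotone convergence applies. It is used with `g` the identity for `N ω` and with 1 -
e^{-x} for `Λ`. -/
lemma tendsto_setLIntegral_eapprox [OpensMeasurableSpace E] (μ : Measure E) {φ : E → ℝ≥0∞}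
    (hφ : Measurable φ) {g : ℝ≥0∞ → ℝ≥0∞} (hg : Monotone g) (hgc : Continuous g) (x₀ : E) :
    Tendsto (fun n : ℕ => ∫⁻ x in Metric.ball x₀ n, g (SimpleFunc.eapprox φ n x) ∂μ) atTop
      (𝓝 (∫⁻ x, g (φ x) ∂μ)) := by
  simp_rw [← lintegral_indicator (μ := μ) Metric.isOpen_ball.measurableSet]
  refine lintegral_tendsto_of_tendsto_of_monotone (fun n => ?_) (ae_of_all _ fun x n m hnm => ?_)
    (ae_of_all _ fun x => ?_)
  · exact ((hgc.measurable.comp (SimpleFunc.measurable _)).indicator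
      Metric.isOpen_ball.measurableSet).aemeasurable
  · refine (indicator_le_indicator_of_subset (Metric.ball_subset_ball (Nat.cast_le.2 hnm))
      (fun _ => zero_le) x).trans ?_
    exact indicator_le_indicator (hg (SimpleFunc.monotone_eapprox φ hnm x))
  · have h1 : Tendsto (fun n => SimpleFunc.eapprox φ n x) atTop (𝓝 (φ x)) := by
      rw [← SimpleFunc.iSup_eapprox_apply hφ x]
      exact tendsto_atTop_iSup fun n m hnm => SimpleFunc.monotone_eapprox φ hnm x
    refine ((hgc.tendsto _).comp h1).congr' ?_
    filter_upwards [eventually_gt_atTop ⌈dist x x₀⌉₊] with n hn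
    rw [indicator_of_mem]
    · rfl
    · exact Nat.lt_of_ceil_lt hn

/-- The Laplace functional of a Poisson process. -/
theorem IsPoissonProcess.laplace [OpensMeasurableSpace E] [Nonempty E]
    (hN : IsPoissonProcess P N Λ) {φ : E → ℝ≥0∞} (hφ : Measurable φ) :
    ∫⁻ ω, expNeg (∫⁻ x, φ x ∂(N ω)) ∂P = expNeg (∫⁻ x, (1 - expNeg (φ x)) ∂Λ) := by
  obtain ⟨x₀⟩ := ‹Nonempty E›
  have hB : ∀ n : ℕ, MeasurableSet (Metric.ball x₀ (n : ℝ)) :=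
    fun n => Metric.isOpen_ball.measurableSet
  have hm : ∀ n : ℕ, Measurable fun ω =>
      expNeg (∫⁻ x in Metric.ball x₀ n, SimpleFunc.eapprox φ n x ∂(N ω)) := fun n => by
    have h1 := fun ω =>
      setLIntegral_comp_simpleFunc (N ω) (SimpleFunc.eapprox φ n) (fun c => c) (hB n)
    simp_rw [h1]
    exact measurable_expNeg.comp (Finset.measurable_sum _ fun j _ =>
      (hN.measurable_count _ ((SimpleFunc.measurableSet_preimage _ _).inter (hB n))).const_mul _)
  have hmono : Monotone fun c => 1 - expNeg c :=
    fun a b hab => tsub_le_tsub_left (expNeg_antitone hab) 1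
  have hcont : Continuous fun c => 1 - expNeg c :=
    (ENNReal.continuous_sub_left ENNReal.one_ne_top).comp continuous_expNeg
  have h2 := (continuous_expNeg.tendsto _).comp
    (tendsto_setLIntegral_eapprox Λ hφ hmono hcont x₀)
  refine tendsto_nhds_unique ?_ h2
  have h3 : ∀ n : ℕ, (expNeg ∘ fun n : ℕ =>
      ∫⁻ x in Metric.ball x₀ n, (1 - expNeg (SimpleFunc.eapprox φ n x)) ∂Λ) n =
      ∫⁻ ω, expNeg (∫⁻ x in Metric.ball x₀ n, SimpleFunc.eapprox φ n x ∂(N ω)) ∂P := fun n =>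
    (hN.laplace_simpleFunc _ (hB n) Metric.isBounded_ball).symm
  refine Tendsto.congr (fun n => (h3 n).symm) ?_
  refine tendsto_lintegral_of_dominated_convergence (fun _ => 1) hm
    (fun n => ae_of_all _ fun ω => expNeg_le_one _) (by simp) (ae_of_all _ fun ω => ?_)
  exact (continuous_expNeg.tendsto _).comp
    (tendsto_setLIntegral_eapprox (N ω) hφ monotone_id continuous_id x₀)

/-- The probability that a Poisson process has at least two points in a set is at most the square
of the mean. -/
lemma IsPoissonProcess.measure_two_le (hN : IsPoissonProcess P N Λ) {B : Set E}
    (hB : MeasurableSet B) (hb : Bornology.IsBounded B) :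
    P {ω | 2 ≤ N ω B} ≤ Λ B ^ 2 := by
  have hmB := hN.measurable_count B hB
  have hl : ∀ n : ℕ, P {ω | N ω B = n} = poissonMeasure (Λ B).toNNReal {n} := fun n => by
    have := hN.law_counts 1 (fun _ => B) (fun _ => hB) (fun _ => hb)
      (fun i j hij => absurd (Subsingleton.elim i j) hij) (fun _ => n)
    simpa using this
  have h01 : P ({ω | N ω B = (0 : ℕ)} ∪ {ω | N ω B = (1 : ℕ)}) =
      P {ω | N ω B = (0 : ℕ)} + P {ω | N ω B = (1 : ℕ)} := by
    refine measure_union ?_ (hmB (measurableSet_singleton _))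
    rw [Set.disjoint_left]
    intro ω h0 h1
    simp only [mem_ofPred_eq] at h0 h1
    rw [h0] at h1
    norm_num at h1
  have hsub : {ω | 2 ≤ N ω B} ⊆ ({ω | N ω B = (0 : ℕ)} ∪ {ω | N ω B = (1 : ℕ)})ᶜ := by
    rintro ω h2 (h0 | h0) <;>
    · simp only [mem_ofPred_eq] at h0 h2
      rw [h0] at h2
      norm_num at h2
  refine (measure_mono hsub).trans ?_
  have hms : ∀ n : ℕ, MeasurableSet {ω | N ω B = n} := fun n => hmB (measurableSet_singleton _)
  rw [prob_compl_eq_one_sub ((hms 0).union (hms 1)), h01, hl, hl, poissonMeasure_singleton,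
    poissonMeasure_singleton, ← ENNReal.coe_toNNReal (hN.finite_of_bounded B hb).ne]
  set m := (Λ B).toNNReal
  simp only [ENNReal.toNNReal_coe, pow_zero, Nat.factorial, pow_one, Nat.cast_one]
  rw [← ENNReal.ofReal_add (by positivity) (by positivity), ← ENNReal.ofReal_one,
    ← ENNReal.ofReal_sub _ (by positivity), ← ENNReal.ofReal_coe_nnreal,
    ← ENNReal.ofReal_pow m.coe_nonneg]
  refine ENNReal.ofReal_le_ofReal ?_
  -- Multiplying 1 - m ≤ e^{-m} by 1 + m gives 1 - e^{-m}(1 + m) ≤ m².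
  have h1 := Real.add_one_le_exp (-(m : ℝ))
  have h2 := mul_le_mul_of_nonneg_right h1 (by positivity : (0 : ℝ) ≤ 1 + m)
  norm_num
  nlinarith

end Poisson

/-! ### Uniqueness of Laplace transforms on [0, ∞]ᵏ -/

section LaplaceTransform

variable {k : ℕ}

/-- The bounded continuous function `x ↦ exp (- ∑ j, m j * x j)` on `[0, ∞]ᵏ`. -/
def expMonomial (m : Fin k → ℕ) : BoundedContinuousFunction (Fin k → ℝ≥0∞) ℝ :=
  BoundedContinuousFunction.ofNormedAddCommGroup
    (fun x => (expNeg (∑ j, (m j : ℝ≥0∞) * x j)).toReal)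
    (ENNReal.continuousOn_toReal.comp_continuous
      (continuous_expNeg.comp (continuous_finsetSum _ fun j _ =>
        (ENNReal.continuous_const_mul (ENNReal.natCast_ne_top _)).comp (continuous_apply j)))
      fun x => expNeg_ne_top _) 1
    (fun x => by
      rw [Real.norm_of_nonneg ENNReal.toReal_nonneg]
      exact ENNReal.toReal_le_of_le_ofReal zero_le_one (by simpa using expNeg_le_one _))

lemma expMonomial_apply (m : Fin k → ℕ) (x : Fin k → ℝ≥0∞) :
    expMonomial m x = (expNeg (∑ j, (m j : ℝ≥0∞) * x j)).toReal := rfl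

/-- The exponential monomials form a submonoid. -/
def expMonomialSubmonoid (k : ℕ) : Submonoid (BoundedContinuousFunction (Fin k → ℝ≥0∞) ℝ) where
  carrier := range expMonomial
  one_mem' := ⟨0, by ext x; simp [expMonomial_apply, expNeg_zero]⟩
  mul_mem' := by
    rintro _ _ ⟨m, rfl⟩ ⟨n, rfl⟩
    refine ⟨m + n, ?_⟩
    ext x
    simp [expMonomial_apply, add_mul, Finset.sum_add_distrib, expNeg_add]

/-- The algebra generated by the exponential monomials. -/
def expMonomialAlgebra (k : ℕ) :
    StarSubalgebra ℝ (BoundedContinuousFunction (Fin k → ℝ≥0∞) ℝ) where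
  toSubalgebra := Algebra.adjoin ℝ (expMonomialSubmonoid k)
  star_mem' := fun {a} ha => by
    have : star a = a := by ext x; simp
    rw [this]; exact ha

/-- Finite measures on `[0, ∞]ᵏ` are determined by their Laplace transforms at the points of
`ℕᵏ`. -/
theorem ext_of_lintegral_expNeg {μ ν : Measure (Fin k → ℝ≥0∞)} [IsFiniteMeasure μ]
    [IsFiniteMeasure ν]
    (h : ∀ m : Fin k → ℕ, ∫⁻ x, expNeg (∑ j, (m j : ℝ≥0∞) * x j) ∂μ =
      ∫⁻ x, expNeg (∑ j, (m j : ℝ≥0∞) * x j) ∂ν) : μ = ν := by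
  -- The monomials separate points, ∞ included, because `expNeg` is injective. They are closed under
  -- products, so the algebra they generate is their linear span, on which the hypothesis extends by
  -- linearity.
  refine ext_of_forall_mem_subalgebra_integral_eq_of_polish (𝕜 := ℝ) (A := expMonomialAlgebra k)
    ?_ ?_
  · intro x y hxy
    obtain ⟨j, hj⟩ := Function.ne_iff.1 hxy
    refine ⟨expMonomial (Pi.single j 1), ⟨_, ⟨expMonomial (Pi.single j 1),
      Algebra.subset_adjoin ⟨_, rfl⟩, rfl⟩, rfl⟩, ?_⟩
    have h1 : ∀ z : Fin k → ℝ≥0∞,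
        ∑ i, (((Pi.single j 1 : Fin k → ℕ) i : ℕ) : ℝ≥0∞) * z i = z j := fun z => by
      rw [Finset.sum_eq_single j] <;> simp +contextual
    rw [expMonomial_apply, expMonomial_apply, h1, h1]
    intro he
    exact hj (expNeg_injective ((ENNReal.toReal_eq_toReal_iff' (expNeg_ne_top _)
      (expNeg_ne_top _)).1 he))
  · intro g hg
    have hg' : g ∈ Submodule.span ℝ (expMonomialSubmonoid k : Set
        (BoundedContinuousFunction (Fin k → ℝ≥0∞) ℝ)) := by
      have h2 := Algebra.adjoin_eq_span ℝ (expMonomialSubmonoid k : Set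
        (BoundedContinuousFunction (Fin k → ℝ≥0∞) ℝ))
      rw [Submonoid.closure_eq] at h2
      rw [← h2]
      exact hg
    clear hg
    induction hg' using Submodule.span_induction with
    | mem x hx =>
      obtain ⟨m, rfl⟩ := hx
      simp only [expMonomial_apply]
      have hm : Measurable fun x : Fin k → ℝ≥0∞ => expNeg (∑ j, (m j : ℝ≥0∞) * x j) :=
        measurable_expNeg.comp (Finset.measurable_sum _ fun j _ =>
          (measurable_pi_apply j).const_mul _)
      rw [integral_toReal hm.aemeasurable (ae_of_all _ fun x => (expNeg_ne_top _).lt_top),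
        integral_toReal hm.aemeasurable (ae_of_all _ fun x => (expNeg_ne_top _).lt_top), h]
    | zero => simp
    | add x y hx hy ihx ihy =>
      simp only [BoundedContinuousFunction.coe_add, Pi.add_apply]
      rw [integral_add (x.integrable μ) (y.integrable μ),
        integral_add (x.integrable ν) (y.integrable ν), ihx, ihy]
    | smul c x hx ih =>
      simp only [BoundedContinuousFunction.coe_smul]
      rw [integral_smul, integral_smul, ih]

end LaplaceTransform

/-! ### Errors over small intervals, and thin annuli -/

/-- A measure inequality up to an error that is quadratic in the length holds without the error. -/
lemma measure_Ioc_le_of_quadratic {μ ν : Measure ℝ} {C a b : ℝ} (hC : 0 ≤ C) (hab : a ≤ b)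
    (h : ∀ x y, a ≤ x → x ≤ y → y ≤ b →
      μ (Ioc x y) ≤ ν (Ioc x y) + ENNReal.ofReal (C * (y - x) ^ 2)) :
    μ (Ioc a b) ≤ ν (Ioc a b) := by
  -- Cutting into n + 1 equal pieces leaves the total error (n + 1) · C((b - a)/(n + 1))².
  have key : ∀ n : ℕ, μ (Ioc a b) ≤
      ν (Ioc a b) + ENNReal.ofReal (C * (b - a) ^ 2 / ((n : ℝ) + 1)) := by
    intro n
    have hn : (0 : ℝ) < (n : ℝ) + 1 := by positivity
    set d : ℝ := (b - a) / ((n : ℝ) + 1) with hd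
    have hd0 : 0 ≤ d := div_nonneg (sub_nonneg.2 hab) hn.le
    have hdn : a + ((n : ℝ) + 1) * d = b := by rw [hd]; field_simp; ring
    have hstep : ∀ k : ℕ, k ≤ n + 1 → μ (Ioc a (a + k * d)) ≤
        ν (Ioc a (a + k * d)) + ENNReal.ofReal (k * (C * d ^ 2)) := by
      intro k
      induction k with
      | zero => simp
      | succ k ih =>
        intro hk
        have hk' : ((k + 1 : ℕ) : ℝ) ≤ (n : ℝ) + 1 := by exact_mod_cast hk
        have h0 : a ≤ a + k * d := by have : 0 ≤ (k : ℝ) * d := by positivity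
                                      linarith
        have h1 : a + k * d ≤ a + (k + 1 : ℕ) * d := by push_cast; nlinarith
        have h2 : a + (k + 1 : ℕ) * d ≤ b := by rw [← hdn]; gcongr
        have h3 := h _ _ h0 h1 h2
        have hdisj : Disjoint (Ioc a (a + k * d)) (Ioc (a + k * d) (a + (k + 1 : ℕ) * d)) :=
          Ioc_disjoint_Ioc_of_le le_rfl
        rw [← Ioc_union_Ioc_eq_Ioc h0 h1, measure_union hdisj measurableSet_Ioc,
          measure_union hdisj measurableSet_Ioc]
        have h4 : a + (k + 1 : ℕ) * d - (a + k * d) = d := by push_cast; ring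
        rw [h4] at h3
        calc _ ≤ _ := add_le_add (ih (by omega)) h3
          _ = _ := by
            have : ((k + 1 : ℕ) : ℝ) * (C * d ^ 2) = k * (C * d ^ 2) + C * d ^ 2 := by
              push_cast; ring
            rw [this, ENNReal.ofReal_add (by positivity) (by positivity)]
            ring
    have h5 := hstep (n + 1) le_rfl
    push_cast at h5
    rw [hdn] at h5
    refine h5.trans (le_of_eq ?_)
    congr 2
    rw [hd]; field_simp
  refine ge_of_tendsto' (f := fun n : ℕ => ν (Ioc a b) +
    ENNReal.ofReal (C * (b - a) ^ 2 / ((n : ℝ) + 1))) (x := atTop) ?_ key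
  have h6 : Tendsto (fun n : ℕ => C * (b - a) ^ 2 / ((n : ℝ) + 1)) atTop (𝓝 0) :=
    tendsto_const_nhds.div_atTop (tendsto_natCast_atTop_atTop.atTop_add tendsto_const_nhds)
  have h7 := ENNReal.tendsto_ofReal h6
  rw [ENNReal.ofReal_zero] at h7
  simpa using h7.const_add (ν (Ioc a b))

/-- The points at distance more than `r` from the origin. -/
def outside (r : ℝ) : Set Plane := {x | r < ‖x‖}

lemma measurableSet_outside (r : ℝ) : MeasurableSet (outside r) :=
  measurableSet_lt measurable_const measurable_norm

/-- The points at distance more than `a` and at most `b` from the origin. -/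
def annulus (a b : ℝ) : Set Plane := outside a \ outside b

lemma measurableSet_annulus (a b : ℝ) : MeasurableSet (annulus a b) :=
  (measurableSet_outside a).diff (measurableSet_outside b)

lemma isBounded_annulus (a b : ℝ) : Bornology.IsBounded (annulus a b) :=
  (Metric.isBounded_closedBall (x := (0 : Plane)) (r := b)).subset fun x hx => by
    simpa [outside] using hx.2

lemma isBounded_compl_outside (b : ℝ) : Bornology.IsBounded (outside b)ᶜ :=
  (Metric.isBounded_closedBall (x := (0 : Plane)) (r := b)).subset fun x hx => by
    simpa [outside] using hx

/-- The area is π(y - x)(y + x) once negative radii, whose disks are empty, are replaced by 0.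
Linearity in y - x is what matters: its square is the admissible error. -/
lemma volume_annulus_le {b x y : ℝ} (hxy : x ≤ y) (hyb : y ≤ b) :
    volume (annulus x y) ≤ ENNReal.ofReal (2 * Real.pi * max b 0 * (y - x)) := by
  have h1 : annulus x y = Metric.closedBall (0 : Plane) y \ Metric.closedBall 0 x := by
    ext z; simp [annulus, outside, and_comm]
  rw [h1, measure_sdiff (Metric.closedBall_subset_closedBall hxy)
    Metric.isClosed_closedBall.measurableSet.nullMeasurableSet measure_closedBall_lt_top.ne,
    EuclideanSpace.volume_closedBall_fin_two, EuclideanSpace.volume_closedBall_fin_two]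
  have h2 : ∀ r : ℝ, ENNReal.ofReal r = ENNReal.ofReal (max r 0) := fun r => by simp
  have hm := max_le_max_right 0 hxy
  have hm0 : 0 ≤ max x 0 := le_max_right _ _
  rw [h2 x, h2 y, ← ENNReal.ofReal_pow hm0, ← ENNReal.ofReal_pow (hm0.trans hm),
    ← ENNReal.ofReal_mul (by positivity), ← ENNReal.ofReal_mul (by positivity),
    ← ENNReal.ofReal_sub _ (by positivity)]
  refine ENNReal.ofReal_le_ofReal ?_
  have h3 : max y 0 - max x 0 ≤ y - x := by
    rcases max_cases x 0 with ⟨h, _⟩ | ⟨h, _⟩ <;> rcases max_cases y 0 with ⟨h', _⟩ | ⟨h', _⟩ <;>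
      rw [h, h'] <;> linarith
  have h4 : max y 0 + max x 0 ≤ 2 * max b 0 := by
    have := max_le_max_right 0 hyb
    linarith
  have h5 : (max y 0 - max x 0) * (max y 0 + max x 0) ≤ (y - x) * (2 * max b 0) :=
    mul_le_mul h3 h4 (by linarith) (by linarith)
  have := mul_le_mul_of_nonneg_left h5 Real.pi_pos.le
  linarith

/-! ### The nearest point and the points beyond it -/

section Points

variable {Ω : Type*} {X : ℕ → Ω → Plane}

lemma servingDistance_le (i : ℕ) (ω : Ω) : servingDistance X ω ≤ ‖X i ω‖ :=
  ciInf_le ⟨0, by rintro _ ⟨j, rfl⟩; exact norm_nonneg _⟩ i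

lemma servingDistance_nonneg (ω : Ω) : 0 ≤ servingDistance X ω :=
  Real.iInf_nonneg fun _ => norm_nonneg _

lemma mem_nonServing_of_lt {i : ℕ} {ω : Ω} (h : servingDistance X ω < ‖X i ω‖) :
    i ∈ nonServing X ω := by
  obtain ⟨j, hj⟩ := exists_lt_of_ciInf_lt h
  exact fun hi => (hi j).not_gt hj

lemma lintegral_sum_dirac (φ : Plane → ℝ≥0∞) (ω : Ω) :
    ∫⁻ x, φ x ∂(Measure.sum fun i => Measure.dirac (X i ω)) = ∑' i, φ (X i ω) := by
  simp [lintegral_sum_measure]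

lemma sum_dirac_apply {B : Set Plane} (hB : MeasurableSet B) (ω : Ω) :
    (Measure.sum fun i => Measure.dirac (X i ω)) B = ∑' i, B.indicator 1 (X i ω) := by
  simp [Measure.sum_apply _ hB]

end Points

section NearestPoint

variable {Ω : Type*} [MeasurableSpace Ω] {P : Measure Ω} [IsProbabilityMeasure P]
  {X : ℕ → Ω → Plane} {Λ : Measure Plane}

lemma measurable_servingDistance (hX : ∀ i, Measurable (X i)) : Measurable (servingDistance X) :=
  Measurable.iInf fun i => (hX i).norm

lemma measurableSet_nonServing (hX : ∀ i, Measurable (X i)) (i : ℕ) :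
    MeasurableSet {ω | i ∈ nonServing X ω} := by
  have : {ω | i ∈ nonServing X ω} = (⋂ j, {ω | ‖X i ω‖ ≤ ‖X j ω‖})ᶜ := by
    ext ω; simp [nonServing]
  rw [this]
  exact (MeasurableSet.iInter fun j => measurableSet_le (hX i).norm (hX j).norm).compl

/-- Almost surely some point is closest to the origin. -/
lemma ae_exists_norm_eq_servingDistance
    (hN : IsPoissonProcess P (fun ω => Measure.sum fun i => Measure.dirac (X i ω)) Λ) :
    ∀ᵐ ω ∂P, ∃ i, ‖X i ω‖ = servingDistance X ω := by
  have h1 : ∀ n : ℕ, ∀ᵐ ω ∂P, (Measure.sum fun i => Measure.dirac (X i ω))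
      (outside n)ᶜ < ∞ := fun n =>
    hN.ae_lt_top (measurableSet_outside _).compl (isBounded_compl_outside _)
  filter_upwards [ae_all_iff.2 h1] with ω hω
  obtain ⟨n, hn⟩ := exists_nat_gt (servingDistance X ω)
  obtain ⟨i, hi⟩ := exists_lt_of_ciInf_lt hn
  have h2 := hω n
  rw [sum_dirac_apply (measurableSet_outside _).compl] at h2
  -- Each point of the disk adds 1 to a finite sum, so the disk holds finitely many points and the
  -- infimum is a minimum over them.
  have hfin := ENNReal.finite_const_le_of_tsum_ne_top h2.ne (ε := 1) one_ne_zero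
  have hmem : ∀ j, ‖X j ω‖ ≤ n →
      j ∈ {i | 1 ≤ (outside n)ᶜ.indicator (1 : Plane → ℝ≥0∞) (X i ω)} := fun j hj => by
    have : X j ω ∈ (outside (n : ℝ))ᶜ := by simpa [outside] using hj
    simp [indicator_of_mem this]
  obtain ⟨j, -, hj⟩ := Set.exists_min_image _ (fun j => ‖X j ω‖) hfin ⟨i, hmem i hi.le⟩
  refine ⟨j, le_antisymm (le_ciInf fun l => ?_) (servingDistance_le j ω)⟩
  by_cases hl : ‖X l ω‖ ≤ n
  · exact hj l (hmem l hl)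
  · exact (hj i (hmem i hi.le)).trans (hi.le.trans (not_le.1 hl).le)

/-- The Laplace functional of the points outside a disk, on the event that a smaller disk is
empty. -/
lemma setLIntegral_expNeg_outside (hX : ∀ i, Measurable (X i))
    (hN : IsPoissonProcess P (fun ω => Measure.sum fun i => Measure.dirac (X i ω)) Λ)
    {ψ : Plane → ℝ≥0∞} (hψ : Measurable ψ) {a b : ℝ} (hab : a ≤ b) :
    ∫⁻ ω in servingDistance X ⁻¹' Ioi a,
        expNeg (∑' i, (outside b).indicator ψ (X i ω)) ∂P =
      expNeg (Λ (outside a)ᶜ) * expNeg (∫⁻ x in outside b, (1 - expNeg (ψ x)) ∂Λ) := by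
  have hma := (measurableSet_outside a).compl
  have hmb := measurableSet_outside b
  have hsub : ∀ x, x ∈ (outside a)ᶜ → x ∉ outside b := fun x hx hxb =>
    hx (lt_of_le_of_lt hab hxb)
  -- The weight ∞ on the closed disk makes the exponential vanish unless the disk is empty; as 1 -
  -- e^{-∞} = 1, it contributes exactly the mass of the disk.
  have hφ : Measurable ((outside a)ᶜ.indicator (fun _ => ∞) + (outside b).indicator ψ) :=
    (measurable_const.indicator hma).add (hψ.indicator hmb)
  have h1 := hN.laplace hφ
  have h2 : ∫⁻ x, (1 - expNeg (((outside a)ᶜ.indicator (fun _ => ∞) +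
      (outside b).indicator ψ) x)) ∂Λ =
      Λ (outside a)ᶜ + ∫⁻ x in outside b, (1 - expNeg (ψ x)) ∂Λ := by
    rw [← lintegral_indicator_one hma, ← lintegral_indicator hmb,
      ← lintegral_add_left (measurable_one.indicator hma)]
    refine lintegral_congr fun x => ?_
    by_cases hxa : x ∈ (outside a)ᶜ
    · simp [indicator_of_mem hxa, indicator_of_notMem (hsub x hxa), expNeg_top]
    · by_cases hxb : x ∈ outside b
      · simp [indicator_of_notMem hxa, indicator_of_mem hxb]
      · simp [indicator_of_notMem hxa, indicator_of_notMem hxb, expNeg_zero]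
  rw [h2, expNeg_add] at h1
  rw [← h1, ← lintegral_indicator (measurable_servingDistance hX measurableSet_Ioi)]
  -- Attainment of the infimum is essential: R ≤ a must place an actual point in the closed disk of
  -- radius a.
  refine lintegral_congr_ae ?_
  filter_upwards [ae_exists_norm_eq_servingDistance hN] with ω ⟨i, hi⟩
  rw [lintegral_sum_dirac]
  have hadd := ENNReal.tsum_add (f := fun j => (outside a)ᶜ.indicator (fun _ => ∞) (X j ω))
    (g := fun j => (outside b).indicator ψ (X j ω))
  rw [show ∑' j, ((outside a)ᶜ.indicator (fun _ => ∞) + (outside b).indicator ψ) (X j ω) = _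
    from hadd]
  by_cases hR : ω ∈ servingDistance X ⁻¹' Ioi a
  · rw [indicator_of_mem hR]
    have : ∀ j, X j ω ∉ (outside a)ᶜ := fun j hj =>
      hj (lt_of_lt_of_le hR (servingDistance_le j ω))
    have hz : ∑' j, (outside a)ᶜ.indicator (fun _ => ∞) (X j ω) = (0 : ℝ≥0∞) :=
      ENNReal.tsum_eq_zero.2 fun j => indicator_of_notMem (this j) _
    rw [hz, zero_add]
  · rw [indicator_of_notMem hR]
    have : X i ω ∈ (outside a)ᶜ := fun h => hR (by
      have h' : a < ‖X i ω‖ := h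
      rwa [hi] at h')
    have htop : ∑' j, (outside a)ᶜ.indicator (fun _ => ∞) (X j ω) = ∞ :=
      ENNReal.tsum_eq_top_of_eq_top ⟨i, indicator_of_mem this _⟩
    rw [htop, top_add, expNeg_top]

lemma map_servingDistance_Ioi (hX : ∀ i, Measurable (X i))
    (hN : IsPoissonProcess P (fun ω => Measure.sum fun i => Measure.dirac (X i ω)) Λ) (a : ℝ) :
    P.map (servingDistance X) (Ioi a) = expNeg (Λ (outside a)ᶜ) := by
  have h := setLIntegral_expNeg_outside hX hN (ψ := 0) measurable_zero (le_refl a)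
  simp [expNeg_zero] at h
  rw [Measure.map_apply (measurable_servingDistance hX) measurableSet_Ioi, h]

lemma measure_compl_outside_add (Λ : Measure Plane) {x y : ℝ} (hxy : x ≤ y) :
    Λ (outside y)ᶜ = Λ (outside x)ᶜ + Λ (annulus x y) := by
  rw [← measure_union _ (measurableSet_annulus x y)]
  · congr 1
    ext z
    simp only [annulus, outside, mem_compl_iff, mem_union, Set.mem_sdiff, mem_ofPred_eq]
    constructor
    · intro h
      by_cases h' : x < ‖z‖
      · exact Or.inr ⟨h', h⟩
      · exact Or.inl h'
    · rintro (h | h)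
      · exact fun h' => h (hxy.trans_lt h')
      · exact h.2
  · exact Set.disjoint_left.2 fun z hz hz' => hz hz'.1

lemma map_servingDistance_Ioc_le (hX : ∀ i, Measurable (X i))
    (hN : IsPoissonProcess P (fun ω => Measure.sum fun i => Measure.dirac (X i ω)) Λ) {x y : ℝ}
    (hxy : x ≤ y) : P.map (servingDistance X) (Ioc x y) ≤ Λ (annulus x y) := by
  have h1 : P.map (servingDistance X) (Ioc x y) + expNeg (Λ (outside y)ᶜ) =
      expNeg (Λ (outside x)ᶜ) := by
    rw [← map_servingDistance_Ioi hX hN, ← map_servingDistance_Ioi hX hN,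
      ← measure_union Ioc_disjoint_Ioi_same measurableSet_Ioi, Ioc_union_Ioi_eq_Ioi hxy]
  have h2 := expNeg_le_expNeg_add (Λ (outside x)ᶜ) (Λ (annulus x y))
  rw [← measure_compl_outside_add Λ hxy, ← h1, add_comm] at h2
  exact (ENNReal.add_le_add_iff_left (expNeg_ne_top _)).1 h2

/-- Subtracting the formula for R > y from the one for R > x, with the same outer radius y, leaves a
product: points beyond y are independent of {x < R ≤ y}. -/
lemma setLIntegral_Ioc_expNeg_outside (hX : ∀ i, Measurable (X i))
    (hN : IsPoissonProcess P (fun ω => Measure.sum fun i => Measure.dirac (X i ω)) Λ)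
    {ψ : Plane → ℝ≥0∞} (hψ : Measurable ψ) {x y : ℝ} (hxy : x ≤ y) :
    ∫⁻ ω in servingDistance X ⁻¹' Ioc x y,
        expNeg (∑' i, (outside y).indicator ψ (X i ω)) ∂P =
      P.map (servingDistance X) (Ioc x y) *
        expNeg (∫⁻ x in outside y, (1 - expNeg (ψ x)) ∂Λ) := by
  have hR := measurable_servingDistance hX
  have h1 := setLIntegral_expNeg_outside hX hN hψ hxy
  have h2 := setLIntegral_expNeg_outside hX hN hψ (le_refl y)
  rw [← map_servingDistance_Ioi hX hN] at h1 h2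
  rw [← Ioc_union_Ioi_eq_Ioi hxy, preimage_union, lintegral_union (hR measurableSet_Ioi)
    (Ioc_disjoint_Ioi_same.preimage _), h2,
    measure_union Ioc_disjoint_Ioi_same measurableSet_Ioi, add_mul] at h1
  refine (ENNReal.add_left_inj ?_).1 h1
  exact ENNReal.mul_ne_top (measure_ne_top _ _) (expNeg_ne_top _)

end NearestPoint

section Points

variable {Ω : Type*} {X : ℕ → Ω → Plane}

lemma tsum_outside_le_nonServing {ψ : Plane → ℝ≥0∞} {y : ℝ} {ω : Ω}
    (h : servingDistance X ω ≤ y) :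
    ∑' i, (outside y).indicator ψ (X i ω) ≤
      ∑' i, (nonServing X ω).indicator (fun i => ψ (X i ω)) i := by
  refine ENNReal.tsum_le_tsum fun i => ?_
  by_cases hi : X i ω ∈ outside y
  · have : i ∈ nonServing X ω := mem_nonServing_of_lt (h.trans_lt hi)
    rw [indicator_of_mem hi, indicator_of_mem this]
  · rw [indicator_of_notMem hi]
    exact zero_le

/-- A non-serving point within distance y would lie in the annulus together with the nearest point,
making two. -/
lemma nonServing_le_tsum_outside {ψ : Plane → ℝ≥0∞} {x y : ℝ} {ω : Ω}
    (hmin : ∃ i, ‖X i ω‖ = servingDistance X ω) (h : servingDistance X ω ∈ Ioc x y)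
    (h2 : ¬ 2 ≤ (Measure.sum fun i => Measure.dirac (X i ω)) (annulus x y)) :
    ∑' i, (nonServing X ω).indicator (fun i => ψ (X i ω)) i ≤
      ∑' i, (outside y).indicator ψ (X i ω) := by
  refine ENNReal.tsum_le_tsum fun i => ?_
  by_cases hi : i ∈ nonServing X ω
  · have hiy : X i ω ∈ outside y := by
      by_contra hiy
      obtain ⟨j, hj⟩ := hmin
      have hij : j ≠ i := by
        rintro rfl
        exact hi fun l => hj.le.trans (servingDistance_le l ω)
      have hmj : X j ω ∈ annulus x y := ⟨by rw [outside, mem_ofPred_eq, hj]; exact h.1,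
        by rw [outside, mem_ofPred_eq, hj, not_lt]; exact h.2⟩
      have hmi : X i ω ∈ annulus x y := ⟨h.1.trans_le (servingDistance_le i ω), hiy⟩
      refine h2 ?_
      rw [sum_dirac_apply (measurableSet_annulus x y)]
      refine le_trans ?_ (ENNReal.sum_le_tsum {j, i})
      rw [Finset.sum_pair hij, indicator_of_mem hmj, indicator_of_mem hmi]
      norm_num
    rw [indicator_of_mem hi, indicator_of_mem hiy]
  · rw [indicator_of_notMem hi]
    exact zero_le

end Points

/-! ### The non-serving points given the serving distance -/

section ServingDistance

variable {Ω : Type*} [MeasurableSpace Ω] {P : Measure Ω} [IsProbabilityMeasure P]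
  {X : ℕ → Ω → Plane} {Λ : Measure Plane}

lemma measurable_tsum_nonServing (hX : ∀ i, Measurable (X i)) {Z : ℕ → Ω → ℝ≥0∞}
    (hZ : ∀ i, Measurable (Z i)) :
    Measurable fun ω => ∑' i, (nonServing X ω).indicator (fun i => Z i ω) i := by
  refine Measurable.tsum fun i => ?_
  have : (fun ω => (nonServing X ω).indicator (fun i => Z i ω) i) =
      {ω | i ∈ nonServing X ω}.indicator (Z i) := by
    ext ω
    by_cases h : i ∈ nonServing X ω
    · rw [indicator_of_mem h, indicator_of_mem (show ω ∈ {ω | i ∈ nonServing X ω} from h)]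
    · rw [indicator_of_notMem h, indicator_of_notMem (show ω ∉ {ω | i ∈ nonServing X ω} from h)]
  rw [this]
  exact (hZ i).indicator (measurableSet_nonServing hX i)

/-- Conditionally on the serving distance `r`, the non-serving points have the Laplace functional of
a Poisson process restricted to the points at distance more than `r`. -/
theorem setLIntegral_expNeg_nonServing (hX : ∀ i, Measurable (X i)) {c : ℝ≥0}
    (hN : IsPoissonProcess P (fun ω => Measure.sum fun i => Measure.dirac (X i ω))
      ((c : ℝ≥0∞) • volume))
    {ψ : Plane → ℝ≥0∞} (hψ : Measurable ψ) {A : Set ℝ} (hA : MeasurableSet A) :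
    ∫⁻ ω in servingDistance X ⁻¹' A,
        expNeg (∑' i, (nonServing X ω).indicator (fun i => ψ (X i ω)) i) ∂P =
      ∫⁻ r in A, expNeg (∫⁻ x in outside r, (1 - expNeg (ψ x)) ∂((c : ℝ≥0∞) • volume))
        ∂(P.map (servingDistance X)) := by
  set Λ : Measure Plane := (c : ℝ≥0∞) • volume with hΛ
  set R := servingDistance X
  set Q := P.map R
  set S : Ω → ℝ≥0∞ := fun ω =>
    expNeg (∑' i, (nonServing X ω).indicator (fun i => ψ (X i ω)) i) with hS
  set H : ℝ → ℝ≥0∞ := fun r => expNeg (∫⁻ x in outside r, (1 - expNeg (ψ x)) ∂Λ) with hH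
  have hR : Measurable R := measurable_servingDistance hX
  have hSm : Measurable S :=
    measurable_expNeg.comp (measurable_tsum_nonServing hX fun i => hψ.comp (hX i))
  have hHmono : Monotone H := fun r s hrs =>
    expNeg_antitone (lintegral_mono_set fun x hx => lt_of_le_of_lt hrs hx)
  have hHm : Measurable H := hHmono.measurable
  have : IsFiniteMeasure (P.withDensity S) := isFiniteMeasure_withDensity
    (((lintegral_mono fun ω => expNeg_le_one _).trans_lt (by simp)).ne)
  have : IsFiniteMeasure (Q.withDensity H) := isFiniteMeasure_withDensity
    (((lintegral_mono fun ω => expNeg_le_one _).trans_lt (by simp)).ne)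
  -- As an equality of finite measures on the line, the claim need only be checked on intervals (x,
  -- y].
  suffices h : (P.withDensity S).map R = Q.withDensity H by
    have h1 := congrArg (fun μ => μ A) h
    simpa [Measure.map_apply hR hA, withDensity_apply _ (hR hA), withDensity_apply _ hA] using h1
  have hHdiff : ∀ r y, r ≤ y → H y ≤ H r + Λ (annulus r y) := by
    intro r y hry
    have hsplit : ∫⁻ x in outside r, (1 - expNeg (ψ x)) ∂Λ ≤
        ∫⁻ x in outside y, (1 - expNeg (ψ x)) ∂Λ + Λ (annulus r y) := by
      have : outside r ⊆ outside y ∪ annulus r y := fun z hz => by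
        by_cases h : z ∈ outside y
        · exact Or.inl h
        · exact Or.inr ⟨hz, h⟩
      refine (lintegral_mono_set this).trans ((lintegral_union_le _ _ _).trans ?_)
      gcongr
      calc _ ≤ ∫⁻ x in annulus r y, 1 ∂Λ := lintegral_mono fun x => tsub_le_self
        _ = _ := by simp
    exact (expNeg_le_expNeg_add _ (Λ (annulus r y))).trans
      (add_le_add_left (expNeg_antitone hsplit) _)
  have hMle : ∀ x y, x ≤ y → (P.withDensity S).map R (Ioc x y) ≤ Q (Ioc x y) * H y := by
    intro x y hxy
    rw [← setLIntegral_Ioc_expNeg_outside hX hN hψ hxy, Measure.map_apply hR measurableSet_Ioc,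
      withDensity_apply _ (hR measurableSet_Ioc)]
    refine setLIntegral_mono' (hR measurableSet_Ioc) fun ω hω => ?_
    exact expNeg_antitone (tsum_outside_le_nonServing hω.2)
  have hleM : ∀ x y, x ≤ y →
      Q (Ioc x y) * H y ≤ (P.withDensity S).map R (Ioc x y) + Λ (annulus x y) ^ 2 := by
    intro x y hxy
    set bad : Set Ω :=
      {ω | 2 ≤ (Measure.sum fun i => Measure.dirac (X i ω)) (annulus x y)} with hbad_def
    have hbad : MeasurableSet bad :=
      measurableSet_le measurable_const (hN.measurable_count _ (measurableSet_annulus x y))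
    rw [← setLIntegral_Ioc_expNeg_outside hX hN hψ hxy, Measure.map_apply hR measurableSet_Ioc,
      withDensity_apply _ (hR measurableSet_Ioc)]
    refine le_trans ?_ (add_le_add_right (hN.measure_two_le (measurableSet_annulus x y)
      (isBounded_annulus x y)) _)
    rw [← lintegral_indicator_one hbad, ← lintegral_indicator (hR measurableSet_Ioc),
      ← lintegral_indicator (hR measurableSet_Ioc),
      ← lintegral_add_right _ (measurable_one.indicator hbad)]
    refine lintegral_mono_ae ?_
    filter_upwards [ae_exists_norm_eq_servingDistance hN] with ω hmin
    by_cases hω : ω ∈ R ⁻¹' Ioc x y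
    · rw [indicator_of_mem hω, indicator_of_mem hω]
      by_cases h2 : 2 ≤ (Measure.sum fun i => Measure.dirac (X i ω)) (annulus x y)
      · rw [indicator_of_mem (show ω ∈ bad from h2)]
        exact (expNeg_le_one _).trans le_add_self
      · exact (expNeg_antitone (nonServing_le_tsum_outside hmin hω h2)).trans le_self_add
    · rw [indicator_of_notMem hω]
      exact zero_le
  have hνle : ∀ x y, Q.withDensity H (Ioc x y) ≤ Q (Ioc x y) * H y := by
    intro x y
    rw [withDensity_apply _ measurableSet_Ioc, mul_comm, ← setLIntegral_const]
    exact setLIntegral_mono' measurableSet_Ioc fun r hr => hHmono hr.2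
  have hleν : ∀ x y, x ≤ y →
      Q (Ioc x y) * H y ≤ Q.withDensity H (Ioc x y) + Λ (annulus x y) ^ 2 := by
    intro x y hxy
    calc Q (Ioc x y) * H y = ∫⁻ r in Ioc x y, H y ∂Q := by rw [setLIntegral_const, mul_comm]
      _ ≤ ∫⁻ r in Ioc x y, (H r + Λ (annulus x y)) ∂Q := by
        refine setLIntegral_mono' measurableSet_Ioc fun r hr => ?_
        refine (hHdiff r y hr.2).trans (add_le_add_right (measure_mono ?_) _)
        exact Set.sdiff_subset_sdiff_left fun z hz => hr.1.trans hz
      _ = Q.withDensity H (Ioc x y) + Λ (annulus x y) * Q (Ioc x y) := by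
        rw [lintegral_add_right _ measurable_const, setLIntegral_const,
          withDensity_apply _ measurableSet_Ioc]
      _ ≤ _ := by
        rw [sq]
        gcongr
        exact map_servingDistance_Ioc_le hX hN hxy
  -- Both measures of (x, y] are at most Q(x, y] · H(y) and fall short of it by at most the squared
  -- annulus mass. Hence each is bounded by the other up to a quadratic error, with `C` the square
  -- of the Lipschitz constant of the annulus mass.
  refine Measure.ext_of_Ioc _ _ fun a b hab => ?_
  set C : ℝ := (c * (2 * Real.pi * max b 0)) ^ 2 with hC
  have hann : ∀ x y, a ≤ x → x ≤ y → y ≤ b →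
      Λ (annulus x y) ^ 2 ≤ ENNReal.ofReal (C * (y - x) ^ 2) := by
    intro x y hax hxy hyb
    have h1 : Λ (annulus x y) ≤ ENNReal.ofReal (c * (2 * Real.pi * max b 0) * (y - x)) := by
      rw [hΛ, Measure.smul_apply, smul_eq_mul, mul_assoc, ENNReal.ofReal_mul c.coe_nonneg,
        ENNReal.ofReal_coe_nnreal]
      gcongr
      exact volume_annulus_le hxy hyb
    have hnn : 0 ≤ (c : ℝ) * (2 * Real.pi * max b 0) * (y - x) :=
      mul_nonneg (by positivity) (sub_nonneg.2 hxy)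
    rw [hC, ← mul_pow, ENNReal.ofReal_pow hnn]
    gcongr
  have hC0 : 0 ≤ C := sq_nonneg _
  refine le_antisymm (measure_Ioc_le_of_quadratic hC0 hab.le fun x y hax hxy hyb => ?_)
    (measure_Ioc_le_of_quadratic hC0 hab.le fun x y hax hxy hyb => ?_)
  · exact (hMle x y hxy).trans ((hleν x y hxy).trans
      (add_le_add_right (hann x y hax hxy hyb) _))
  · exact (hνle x y).trans ((hleM x y hxy).trans
      (add_le_add_right (hann x y hax hxy hyb) _))

end ServingDistance

/-! ### Independent displacement of the non-serving points -/

section Displacement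

variable {Ω : Type*} [MeasurableSpace Ω] {P : Measure Ω} [IsProbabilityMeasure P]
  {X D : ℕ → Ω → Plane} {η : Measure Plane} [IsProbabilityMeasure η]

/-- Displacing the non-serving points independently replaces, in the Laplace functional, the test
function by its average over the displacement. -/
lemma setLIntegral_expNeg_displaced (hX : ∀ i, Measurable (X i)) (hD : ∀ i, Measurable (D i))
    (hη : ∀ i, P.map (D i) = η) (hDind : iIndepFun D P)
    (hXD : IndepFun (fun ω i => X i ω) (fun ω i => D i ω) P)
    {φ ψ : Plane → ℝ≥0∞} (hφ : Measurable φ) (hψ : Measurable ψ)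
    (hφψ : ∀ x, expNeg (ψ x) = ∫⁻ d, expNeg (φ (x + d)) ∂η) {A : Set ℝ} (hA : MeasurableSet A) :
    ∫⁻ ω in servingDistance X ⁻¹' A,
        expNeg (∑' i, (nonServing X ω).indicator (fun i => φ (X i ω + D i ω)) i) ∂P =
      ∫⁻ ω in servingDistance X ⁻¹' A,
        expNeg (∑' i, (nonServing X ω).indicator (fun i => ψ (X i ω)) i) ∂P := by
  set C : ℕ → (ℕ → Plane) → Plane := fun i x => x i with hC
  have hCm : ∀ i, Measurable (C i) := fun i => measurable_pi_apply i
  have hXs : Measurable fun ω i => X i ω := measurable_pi_lambda _ hX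
  have hDs : Measurable fun ω i => D i ω := measurable_pi_lambda _ hD
  have hA' : MeasurableSet (servingDistance C ⁻¹' A) := measurable_servingDistance hCm hA
  have hmeas : Measurable fun p : (ℕ → Plane) × (ℕ → Plane) => expNeg (∑' i,
      (nonServing C p.1).indicator (fun i => φ (p.1 i + p.2 i)) i) :=
    measurable_expNeg.comp (measurable_tsum_nonServing
      (X := fun i (p : (ℕ → Plane) × (ℕ → Plane)) => p.1 i)
      (fun i => (measurable_pi_apply i).comp measurable_fst)
      (Z := fun i p => φ (p.1 i + p.2 i))
      (fun i => hφ.comp (((measurable_pi_apply i).comp measurable_fst).add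
        ((measurable_pi_apply i).comp measurable_snd))))
  have hmeas' : Measurable fun x : ℕ → Plane => expNeg (∑' i,
      (nonServing C x).indicator (fun i => ψ (x i)) i) :=
    measurable_expNeg.comp (measurable_tsum_nonServing hCm fun i => hψ.comp (hCm i))
  -- With the starting points frozen the non-serving indices are deterministic, so independence of
  -- the displacements gives a product of averages. Serving indices contribute the factor 1.
  have hinner : ∀ x : ℕ → Plane,
      ∫⁻ d, expNeg (∑' i, (nonServing C x).indicator (fun i => φ (x i + d i)) i)
        ∂(P.map fun ω i => D i ω) =
      expNeg (∑' i, (nonServing C x).indicator (fun i => ψ (x i)) i) := by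
    intro x
    have hmx : Measurable fun d : ℕ → Plane => expNeg (∑' i,
        (nonServing C x).indicator (fun i => φ (x i + d i)) i) := by
      have h := hmeas.comp (measurable_prodMk_left (β := ℕ → Plane) (x := x))
      exact h
    rw [lintegral_map hmx hDs]
    set g : ℕ → Plane → ℝ≥0∞ := fun i d =>
      (nonServing C x).indicator (fun i => φ (x i + d)) i with hg
    have hgm : ∀ i, Measurable (g i) := fun i => by
      by_cases hi : i ∈ nonServing C x
      · simp only [hg, indicator_of_mem hi]
        exact hφ.comp (measurable_const_add _)
      · simp only [hg, indicator_of_notMem hi]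
        exact measurable_const
    refine lintegral_expNeg_tsum (Z := fun i ω => g i (D i ω)) (fun i => (hgm i).comp (hD i))
      (hDind.comp g hgm) _ fun i => ?_
    have h1 := lintegral_map (μ := P) (measurable_expNeg.comp (hgm i)) (hD i)
    simp only [Function.comp_apply] at h1
    rw [← h1, hη]
    by_cases hi : i ∈ nonServing C x
    · simp only [hg, indicator_of_mem hi, hφψ]
    · simp [hg, indicator_of_notMem hi, expNeg_zero]
  have hlaw := (indepFun_iff_map_prod_eq_prod_map_map hXs.aemeasurable hDs.aemeasurable).1 hXD
  have : IsProbabilityMeasure (P.map fun ω i => X i ω) :=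
    Measure.isProbabilityMeasure_map hXs.aemeasurable
  have : IsProbabilityMeasure (P.map fun ω i => D i ω) :=
    Measure.isProbabilityMeasure_map hDs.aemeasurable
  have h1 : ∫⁻ ω in servingDistance X ⁻¹' A,
      expNeg (∑' i, (nonServing X ω).indicator (fun i => φ (X i ω + D i ω)) i) ∂P =
      ∫⁻ p in (servingDistance C ⁻¹' A) ×ˢ univ, expNeg (∑' i,
        (nonServing C p.1).indicator (fun i => φ (p.1 i + p.2 i)) i)
        ∂(P.map fun ω => (fun i => X i ω, fun i => D i ω)) := by
    rw [setLIntegral_map (hA'.prod MeasurableSet.univ) hmeas (hXs.prodMk hDs)]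
    congr 2
    ext ω
    simp [servingDistance, hC]
  have h2 : ∫⁻ ω in servingDistance X ⁻¹' A,
      expNeg (∑' i, (nonServing X ω).indicator (fun i => ψ (X i ω)) i) ∂P =
      ∫⁻ x in servingDistance C ⁻¹' A, expNeg (∑' i,
        (nonServing C x).indicator (fun i => ψ (x i)) i) ∂(P.map fun ω i => X i ω) := by
    rw [setLIntegral_map hA' hmeas' hXs]
    rfl
  rw [h1, h2, hlaw, setLIntegral_prod _ hmeas.aemeasurable]
  refine lintegral_congr fun x => ?_
  rw [setLIntegral_univ]
  exact hinner x

/-- The intensity of the displaced points that started at distance more than `r`. -/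
def displacedIntensity (c : ℝ≥0) (η : Measure Plane) (r : ℝ) : Measure Plane :=
  (((c : ℝ≥0∞) • volume).restrict (outside r)).conv η

/-- Dropping the truncation leaves Lebesgue measure, and every translate of `B` has the same volume.
-/
lemma displacedIntensity_le (c : ℝ≥0) (r : ℝ) {B : Set Plane} (hB : MeasurableSet B) :
    displacedIntensity c η r B ≤ c * volume B := by
  rw [displacedIntensity, Measure.conv, Measure.map_apply measurable_add hB,
    Measure.prod_apply_symm (measurable_add hB)]
  calc _ ≤ ∫⁻ d, c * volume B ∂η := by
        refine lintegral_mono fun d => (Measure.restrict_apply_le _ _).trans ?_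
        rw [Measure.smul_apply, smul_eq_mul]
        exact mul_le_mul_right (measure_preimage_add_right volume d B).le _
    _ = _ := by simp

lemma displacedIntensity_lt_top (c : ℝ≥0) (r : ℝ) {B : Set Plane} (hb : Bornology.IsBounded B) :
    displacedIntensity c η r B < ∞ := by
  refine (measure_mono subset_closure).trans_lt
    ((displacedIntensity_le c r isClosed_closure.measurableSet).trans_lt ?_)
  exact ENNReal.mul_lt_top ENNReal.coe_lt_top hb.closure.measure_lt_top

/-- Monotonicity in `r` supplies the measurability of the mixed Poisson probabilities. -/
lemma displacedIntensity_antitone (c : ℝ≥0) {B : Set Plane} (hB : MeasurableSet B) :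
    Antitone fun r => displacedIntensity c η r B := by
  intro r s hrs
  simp only [displacedIntensity, Measure.conv, Measure.map_apply measurable_add hB,
    Measure.prod_apply (measurable_add hB)]
  exact lintegral_mono_set fun x hx => lt_of_le_of_lt hrs hx

variable {k : ℕ} {B : Fin k → Set Plane}

/-- By disjointness at most one summand is nonzero at `z`, so the nonlinear function passes through
the sum. -/
lemma one_sub_expNeg_sum_indicator (hd : Pairwise fun j l => Disjoint (B j) (B l))
    (c : Fin k → ℝ≥0∞) (z : Plane) :
    1 - expNeg (∑ j, c j * (B j).indicator 1 z) =
      ∑ j, (1 - expNeg (c j)) * (B j).indicator 1 z := by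
  by_cases h : ∃ j, z ∈ B j
  · obtain ⟨j, hj⟩ := h
    have hne : ∀ l, l ≠ j → z ∉ B l := fun l hl hz => Set.disjoint_left.1 (hd hl) hz hj
    rw [Finset.sum_eq_single j (fun l _ hl => by simp [hne l hl]) (by simp),
      Finset.sum_eq_single j (fun l _ hl => by simp [hne l hl]) (by simp)]
    simp [hj]
  · push Not at h
    simp [h, expNeg_zero]

/-- The joint Laplace transform of the counts of the displaced non-serving points. -/
lemma setLIntegral_expNeg_counts (hX : ∀ i, Measurable (X i)) (hD : ∀ i, Measurable (D i))
    (hη : ∀ i, P.map (D i) = η) (hDind : iIndepFun D P)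
    (hXD : IndepFun (fun ω i => X i ω) (fun ω i => D i ω) P) {c : ℝ≥0}
    (hN : IsPoissonProcess P (fun ω => Measure.sum fun i => Measure.dirac (X i ω))
      ((c : ℝ≥0∞) • volume))
    (hB : ∀ j, MeasurableSet (B j)) (hd : Pairwise fun j l => Disjoint (B j) (B l))
    (m : Fin k → ℝ≥0∞) {A : Set ℝ} (hA : MeasurableSet A) :
    ∫⁻ ω in servingDistance X ⁻¹' A, expNeg (∑ j, m j *
        (Measure.sum fun i : nonServing X ω => Measure.dirac (X i ω + D i ω)) (B j)) ∂P =
      ∫⁻ r in A, expNeg (∑ j, (1 - expNeg (m j)) * displacedIntensity c η r (B j))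
        ∂(P.map (servingDistance X)) := by
  set φ : Plane → ℝ≥0∞ := fun z => ∑ j, m j * (B j).indicator 1 z with hφ_def
  have hφ : Measurable φ := Finset.measurable_sum _ fun j _ =>
    (measurable_one.indicator (hB j)).const_mul _
  have hsum : Measurable fun p : Plane × Plane => expNeg (φ (p.1 + p.2)) :=
    measurable_expNeg.comp (hφ.comp measurable_add)
  have hle : ∀ x, ∫⁻ d, expNeg (φ (x + d)) ∂η ≤ 1 := fun x =>
    (lintegral_mono fun d => expNeg_le_one _).trans (by simp)
  -- The average lies in [0, 1], so it is e^{-ψ} for some ψ in [0, ∞].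
  set ψ : Plane → ℝ≥0∞ := fun x => negLog (∫⁻ d, expNeg (φ (x + d)) ∂η) with hψ_def
  have hψ : Measurable ψ := measurable_negLog.comp hsum.lintegral_prod_right'
  have hφψ : ∀ x, expNeg (ψ x) = ∫⁻ d, expNeg (φ (x + d)) ∂η := fun x => expNeg_negLog (hle x)
  have h1 : ∀ ω, ∑ j, m j *
      (Measure.sum fun i : nonServing X ω => Measure.dirac (X i ω + D i ω)) (B j) =
      ∑' i, (nonServing X ω).indicator (fun i => φ (X i ω + D i ω)) i := by
    intro ω
    rw [← tsum_subtype (nonServing X ω) (fun i => φ (X i ω + D i ω))]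
    simp only [hφ_def]
    rw [Summable.tsum_finsetSum fun _ _ => ENNReal.summable]
    refine Finset.sum_congr rfl fun j _ => ?_
    rw [Measure.sum_apply _ (hB j), ENNReal.tsum_mul_left]
    simp [hB j]
  simp_rw [h1]
  rw [setLIntegral_expNeg_displaced hX hD hη hDind hXD hφ hψ hφψ hA,
    setLIntegral_expNeg_nonServing hX hN hψ hA]
  refine lintegral_congr fun r => congrArg expNeg ?_
  have h2 : ∀ x, 1 - expNeg (ψ x) = ∫⁻ d, (1 - expNeg (φ (x + d))) ∂η := fun x => by
    have hsx : Measurable fun d => expNeg (φ (x + d)) := by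
      have h := hsum.comp (measurable_prodMk_left (β := Plane) (x := x))
      exact h
    rw [hφψ, lintegral_sub hsx ((hle x).trans_lt ENNReal.one_lt_top).ne
      (ae_of_all _ fun d => expNeg_le_one _)]
    simp
  simp_rw [h2, hφ_def, one_sub_expNeg_sum_indicator hd]
  have hm : ∀ j, Measurable fun z => (1 - expNeg (m j)) * (B j).indicator (1 : Plane → ℝ≥0∞) z :=
    fun j => (measurable_one.indicator (hB j)).const_mul _
  rw [← Measure.lintegral_conv (f := fun z => ∑ j, (1 - expNeg (m j)) * (B j).indicator 1 z)
    (Finset.measurable_sum _ fun j _ => hm j), lintegral_finsetSum _ fun j _ => hm j]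
  refine Finset.sum_congr rfl fun j _ => ?_
  rw [lintegral_const_mul _ (measurable_one.indicator (hB j)), lintegral_indicator_one (hB j)]
  rfl

lemma measurable_poissonMeasure_singleton (n : ℕ) :
    Measurable fun r : ℝ≥0 => poissonMeasure r {n} := by
  simp_rw [poissonMeasure_singleton]
  fun_prop

lemma measurable_nonServing_count (hX : ∀ i, Measurable (X i)) (hD : ∀ i, Measurable (D i))
    {B : Set Plane} (hB : MeasurableSet B) : Measurable fun ω =>
      (Measure.sum fun i : nonServing X ω => Measure.dirac (X i ω + D i ω)) B := by
  have h1 : ∀ ω, (Measure.sum fun i : nonServing X ω => Measure.dirac (X i ω + D i ω)) B =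
      ∑' i, (nonServing X ω).indicator (fun i => B.indicator 1 (X i ω + D i ω)) i := by
    intro ω
    rw [← tsum_subtype (nonServing X ω) (fun i => B.indicator 1 (X i ω + D i ω)),
      Measure.sum_apply _ hB]
    simp [hB]
  simp_rw [h1]
  exact measurable_tsum_nonServing hX fun i =>
    (measurable_one.indicator hB).comp ((hX i).add (hD i))

/-- The displacement theorem for the non-serving points: conditionally on the serving distance, the
displaced non-serving points form a Poisson process. -/
theorem isPoissonProcessGiven_displaced (hX : ∀ i, Measurable (X i)) (hD : ∀ i, Measurable (D i))
    (hη : ∀ i, P.map (D i) = η) (hDind : iIndepFun D P)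
    (hXD : IndepFun (fun ω i => X i ω) (fun ω i => D i ω) P) {c : ℝ≥0}
    (hN : IsPoissonProcess P (fun ω => Measure.sum fun i => Measure.dirac (X i ω))
      ((c : ℝ≥0∞) • volume)) :
    IsPoissonProcessGiven P
      (fun ω => Measure.sum fun i : nonServing X ω => Measure.dirac (X i ω + D i ω))
      (servingDistance X) (displacedIntensity c η) where
  measurable_given := measurable_servingDistance hX
  measurable_count B hB := measurable_nonServing_count hX hD hB
  finite_of_bounded := ae_of_all _ fun r B hb => displacedIntensity_lt_top c r hb
  law_counts := by
    intro k B hB hb hd n A hA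
    set Q := P.map (servingDistance X)
    have hR := measurable_servingDistance hX
    set T : Ω → Fin k → ℝ≥0∞ := fun ω j =>
      (Measure.sum fun i : nonServing X ω => Measure.dirac (X i ω + D i ω)) (B j)
    have hT : Measurable T := measurable_pi_lambda _ fun j =>
      measurable_nonServing_count hX hD (hB j)
    set p : (Fin k → ℕ) → ℝ → ℝ≥0∞ := fun n r =>
      ∏ j, poissonMeasure (displacedIntensity c η r (B j)).toNNReal {n j} with hp
    have hpm : ∀ n, Measurable (p n) := fun n => Finset.measurable_prod _ fun j _ =>
      (measurable_poissonMeasure_singleton (n j)).comp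
        (displacedIntensity_antitone c (hB j)).measurable.ennreal_toNNReal
    set μ := (P.restrict (servingDistance X ⁻¹' A)).map T
    -- This is the mixed Poisson law claimed for the counts on {R ∈ A}; its atom at `n` is the
    -- right-hand side sought.
    set ν : Measure (Fin k → ℝ≥0∞) := Measure.sum fun n : Fin k → ℕ =>
      (∫⁻ r in A, p n r ∂Q) • Measure.dirac fun j => (n j : ℝ≥0∞)
    have hexp : ∀ m : Fin k → ℕ, Measurable fun x : Fin k → ℝ≥0∞ =>
        expNeg (∑ j, (m j : ℝ≥0∞) * x j) := fun m =>
      measurable_expNeg.comp (Finset.measurable_sum _ fun j _ =>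
        (measurable_pi_apply j).const_mul _)
    have heq : ∀ m : Fin k → ℕ, ∫⁻ x, expNeg (∑ j, (m j : ℝ≥0∞) * x j) ∂μ =
        ∫⁻ x, expNeg (∑ j, (m j : ℝ≥0∞) * x j) ∂ν := by
      intro m
      rw [lintegral_map (hexp m) hT, setLIntegral_expNeg_counts hX hD hη hDind hXD hN hB hd _ hA,
        lintegral_sum_measure]
      simp_rw [lintegral_smul_measure, lintegral_dirac, smul_eq_mul,
        ← lintegral_mul_const _ (hpm _)]
      rw [← lintegral_tsum fun n => ((hpm n).mul_const _).aemeasurable]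
      refine lintegral_congr fun r => ?_
      have h1 : ∀ n : Fin k → ℕ, p n r * expNeg (∑ j, (m j : ℝ≥0∞) * (n j : ℝ≥0∞)) =
          (∏ j, expNeg (m j) ^ n j) *
            (Measure.pi fun j => poissonMeasure (displacedIntensity c η r (B j)).toNNReal) {n} := by
        intro n
        rw [Measure.pi_singleton, mul_comm, expNeg_sum]
        congr 1
        refine Finset.prod_congr rfl fun j _ => ?_
        rw [mul_comm, expNeg_nat_mul]
      simp_rw [h1]
      rw [← lintegral_countable', lintegral_pi_prod _ (f := fun j n => expNeg (m j) ^ n)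
        (fun _ => measurable_of_countable _), expNeg_sum]
      refine Finset.prod_congr rfl fun j _ => ?_
      rw [lintegral_poissonMeasure_pow _ _ (expNeg_le_one _),
        ENNReal.coe_toNNReal (displacedIntensity_lt_top c r (hb j)).ne]
    -- The Laplace transform at 0 is the total mass, which is that of `μ`.
    have : IsFiniteMeasure ν := ⟨by
      have h0 := heq 0
      simp only [Pi.zero_apply, Nat.cast_zero, zero_mul, Finset.sum_const_zero, expNeg_zero,
        lintegral_one] at h0
      rw [← h0]
      exact measure_lt_top μ univ⟩
    have hμν : μ = ν := ext_of_lintegral_expNeg heq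
    have hμ : P {ω | servingDistance X ω ∈ A ∧ ∀ j, T ω j = (n j : ℝ≥0∞)} =
        μ {fun j => (n j : ℝ≥0∞)} := by
      rw [Measure.map_apply hT (measurableSet_singleton _),
        Measure.restrict_apply (hT (measurableSet_singleton _))]
      congr 1
      ext ω
      simp [funext_iff, and_comm]
    refine hμ.trans ?_
    rw [hμν, Measure.sum_apply _ (measurableSet_singleton _), tsum_eq_single n]
    · simp [hp]
    · intro n' hn'
      have : (fun j => (n' j : ℝ≥0∞)) ≠ fun j => (n j : ℝ≥0∞) := fun h =>
        hn' (funext fun j => by exact_mod_cast congrFun h j)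
      simp [this]

end Displacement

/-! ### The density of the displaced intensity -/

/-- The intensity of the displaced points has as density at `y` the probability that a displaced
point at `y` started at distance more than `r`. -/
lemma displacedIntensity_eq_withDensity {η : Measure Plane} [IsProbabilityMeasure η] (c : ℝ≥0)
    (r : ℝ) :
    displacedIntensity c η r =
      volume.withDensity fun y => (c : ℝ≥0∞) * η {d | r < ‖y - d‖} := by
  have hm : MeasurableSet {p : Plane × Plane | r < ‖p.1 - p.2‖} :=
    measurableSet_lt measurable_const (measurable_fst.sub measurable_snd).norm
  ext B hB
  rw [displacedIntensity, Measure.conv, Measure.map_apply measurable_add hB,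
    Measure.prod_apply_symm (measurable_add hB), withDensity_apply _ hB]
  -- For fixed d the substitution y = x + d preserves volume; the integrals over d and y are then
  -- exchanged.
  have h1 : ∀ d : Plane, ((c : ℝ≥0∞) • volume).restrict (outside r)
      ((fun x => (x, d)) ⁻¹' ((fun p : Plane × Plane => p.1 + p.2) ⁻¹' B)) =
      ∫⁻ y in B, (c : ℝ≥0∞) * {p : Plane × Plane | r < ‖p.1 - p.2‖}.indicator 1 (y, d) := by
    intro d
    have hB' : MeasurableSet ((fun x : Plane => x + d) ⁻¹' B) := measurable_add_const d hB
    have hmd : MeasurableSet {y : Plane | r < ‖y - d‖} :=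
      measurableSet_lt measurable_const (measurable_id.sub_const d).norm
    have h2 : (fun x : Plane => (x, d)) ⁻¹' ((fun p : Plane × Plane => p.1 + p.2) ⁻¹' B) =
        (fun x : Plane => x + d) ⁻¹' B := rfl
    have h3 : (fun x : Plane => x + d) ⁻¹' B ∩ outside r =
        (fun x : Plane => x + d) ⁻¹' (B ∩ {y : Plane | r < ‖y - d‖}) := by
      ext x; simp [outside]
    have h4 : ∀ y, {p : Plane × Plane | r < ‖p.1 - p.2‖}.indicator (1 : Plane × Plane → ℝ≥0∞)
        (y, d) = {y : Plane | r < ‖y - d‖}.indicator 1 y := fun y => by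
      simp [indicator_apply]
    rw [h2, Measure.restrict_apply hB', h3, Measure.smul_apply, smul_eq_mul,
      measure_preimage_add_right]
    simp_rw [h4]
    rw [lintegral_const_mul _ (measurable_one.indicator hmd), lintegral_indicator_one hmd,
      Measure.restrict_apply hmd, inter_comm]
  simp_rw [h1]
  rw [lintegral_lintegral_swap]
  · refine setLIntegral_congr_fun hB fun y _ => ?_
    have hmy : MeasurableSet {d : Plane | r < ‖y - d‖} :=
      measurableSet_lt measurable_const (measurable_id.const_sub y).norm
    have h4 : ∀ d, {p : Plane × Plane | r < ‖p.1 - p.2‖}.indicator (1 : Plane × Plane → ℝ≥0∞)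
        (y, d) = {d : Plane | r < ‖y - d‖}.indicator 1 d := fun d => by
      simp [indicator_apply]
    simp_rw [h4]
    rw [lintegral_const_mul _ (measurable_one.indicator hmy), lintegral_indicator_one hmy]
  · exact (((measurable_one.indicator hm).const_mul _).comp measurable_swap).aemeasurable

/-! ### Uniform directions and the law of cosines -/

/-- The clipped values π and 0 of `Real.arccos` outside [-1, 1] encode impossible and certain
events. Only x = 0 with c > 1 breaks this. -/
lemma cos_lt_iff_arccos_lt_abs {x c : ℝ} (hx0 : x ≠ 0) (hx : |x| ≤ Real.pi) :
    Real.cos x < c ↔ Real.arccos c < |x| := by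
  rw [← Real.cos_abs x]
  have hpos : 0 < |x| := abs_pos.2 hx0
  rcases le_total c (-1) with h | h
  · rw [Real.arccos_of_le_neg_one h]
    exact iff_of_false (h.trans (Real.neg_one_le_cos _)).not_gt hx.not_gt
  rcases le_total 1 c with h' | h'
  · rw [Real.arccos_of_one_le h']
    refine iff_of_true (lt_of_lt_of_le ?_ h') hpos
    rw [← Real.cos_zero]
    exact Real.cos_lt_cos_of_nonneg_of_le_pi le_rfl hx hpos
  · conv_lhs => rw [← Real.cos_arccos h h']
    exact Real.strictAntiOn_cos.lt_iff_gt ⟨hpos.le, hx⟩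
      ⟨Real.arccos_nonneg c, Real.arccos_le_pi c⟩

lemma volume_cos_lt (c : ℝ) :
    volume (Ioc (-Real.pi) Real.pi ∩ {x | Real.cos x < c}) =
      ENNReal.ofReal (2 * (Real.pi - Real.arccos c)) := by
  have ha := Real.arccos_nonneg c
  have ha' := Real.arccos_le_pi c
  have h1 : (Ioc (-Real.pi) Real.pi ∩ {x | Real.cos x < c} : Set ℝ) =ᵐ[volume]
      (Ioo (-Real.pi) (-Real.arccos c) ∪ Ioc (Real.arccos c) Real.pi : Set ℝ) := by
    have h0 : ∀ᵐ x : ℝ, x ≠ 0 := by simp [ae_iff]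
    filter_upwards [h0] with x hx
    refine propext ?_
    change (x ∈ Ioc (-Real.pi) Real.pi ∧ Real.cos x < c) ↔
      (x ∈ Ioo (-Real.pi) (-Real.arccos c) ∨ x ∈ Ioc (Real.arccos c) Real.pi)
    constructor
    · rintro ⟨hxm, hc⟩
      rw [cos_lt_iff_arccos_lt_abs hx (abs_le.2 ⟨hxm.1.le, hxm.2⟩), lt_abs] at hc
      rcases hc with hc | hc
      · exact Or.inr ⟨hc, hxm.2⟩
      · exact Or.inl ⟨hxm.1, by linarith⟩
    · intro h
      have hxm : x ∈ Ioc (-Real.pi) Real.pi := by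
        rcases h with h | h
        · exact ⟨h.1, by linarith [h.2, Real.pi_pos]⟩
        · exact ⟨by linarith [h.1, Real.pi_pos], h.2⟩
      refine ⟨hxm, (cos_lt_iff_arccos_lt_abs hx (abs_le.2 ⟨hxm.1.le, hxm.2⟩)).2 (lt_abs.2 ?_)⟩
      rcases h with h | h
      · exact Or.inr (by linarith [h.2])
      · exact Or.inl h.1
  have hdisj : Disjoint (Ioo (-Real.pi) (-Real.arccos c)) (Ioc (Real.arccos c) Real.pi) :=
    Set.disjoint_left.2 fun x hx hx' => by linarith [hx.2, hx'.1]
  rw [measure_congr h1, measure_union hdisj measurableSet_Ioc, Real.volume_Ioo, Real.volume_Ioc,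
    ← ENNReal.ofReal_add (by linarith) (by linarith)]
  congr 1
  ring

/-- The measure of a periodic set in a period does not depend on the period. -/
lemma volume_Ioc_inter_periodic {S : Set ℝ} (hS : MeasurableSet S) {T : ℝ} (hT : 0 < T)
    (hper : ∀ x, x + T ∈ S ↔ x ∈ S) (a b : ℝ) :
    volume (Ioc a (a + T) ∩ S) = volume (Ioc b (b + T) ∩ S) := by
  have hp : Function.Periodic (S.indicator (1 : ℝ → ℝ)) T := fun x => by
    by_cases hx : x ∈ S
    · rw [indicator_of_mem hx, indicator_of_mem ((hper x).2 hx), Pi.one_apply, Pi.one_apply]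
    · rw [indicator_of_notMem hx, indicator_of_notMem (fun h => hx ((hper x).1 h))]
  have h := hp.intervalIntegral_add_eq a b
  have h1 : ∀ a, ∫ x in a..a + T, S.indicator (1 : ℝ → ℝ) x = volume.real (Ioc a (a + T) ∩ S) := by
    intro a
    rw [intervalIntegral.integral_of_le (by linarith), integral_indicator_one hS,
      measureReal_restrict_apply hS, inter_comm]
  rw [h1, h1] at h
  have hfin : ∀ a, volume (Ioc a (a + T) ∩ S) ≠ ∞ := fun a =>
    ((measure_mono inter_subset_left).trans_lt measure_Ioc_lt_top).ne
  exact (measureReal_eq_measureReal_iff (hfin a) (hfin b)).1 h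

/-- Periodicity removes the shift φ, and the set |x| > arccos c fills the fraction 1 - arccos(c)/π
of a period. -/
lemma cond_Ico_cos_sub_lt (φ c : ℝ) :
    ProbabilityTheory.cond volume (Ico 0 (2 * Real.pi)) {θ : ℝ | Real.cos (θ - φ) < c} =
      ENNReal.ofReal (1 - Real.arccos c / Real.pi) := by
  have hpi := Real.pi_pos
  have hS : MeasurableSet {θ : ℝ | Real.cos (θ - φ) < c} :=
    measurableSet_lt (by fun_prop) measurable_const
  have hS' : MeasurableSet {x : ℝ | Real.cos x < c} :=
    measurableSet_lt (by fun_prop) measurable_const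
  have h1 : volume (Ico 0 (2 * Real.pi) ∩ {θ : ℝ | Real.cos (θ - φ) < c}) =
      ENNReal.ofReal (2 * (Real.pi - Real.arccos c)) := by
    rw [← volume_cos_lt]
    have e1 : volume (Ico 0 (2 * Real.pi) ∩ {θ : ℝ | Real.cos (θ - φ) < c}) =
        volume (Ioc 0 (0 + 2 * Real.pi) ∩ {θ : ℝ | Real.cos (θ - φ) < c}) := by
      rw [zero_add]
      exact measure_congr (Ico_ae_eq_Ioc.inter (ae_eq_refl _))
    rw [e1, volume_Ioc_inter_periodic hS (by positivity)
      (fun x => by simp [show x + 2 * Real.pi - φ = x - φ + 2 * Real.pi by ring]) 0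
      (-Real.pi + φ)]
    have e2 : Ioc (-Real.pi + φ) (-Real.pi + φ + 2 * Real.pi) ∩ {θ : ℝ | Real.cos (θ - φ) < c} =
        (fun x => x + -φ) ⁻¹' (Ioc (-Real.pi) Real.pi ∩ {x | Real.cos x < c}) := by
      ext x
      simp only [mem_inter_iff, mem_Ioc, mem_ofPred_eq, mem_preimage, ← sub_eq_add_neg]
      refine and_congr_left fun _ => ⟨fun h => ⟨?_, ?_⟩, fun h => ⟨?_, ?_⟩⟩ <;>
        linarith [h.1, h.2]
    rw [e2, measure_preimage_add_right]
  rw [ProbabilityTheory.cond_apply measurableSet_Ico, h1, Real.volume_Ico, sub_zero,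
    ← ENNReal.ofReal_inv_of_pos (by positivity), ← ENNReal.ofReal_mul (by positivity)]
  congr 1
  field_simp

/-- The displacement during a time `t` at speed `v` in direction `θ`. -/
def displacement (t : ℝ) (p : ℝ × ℝ) : Plane := (t * p.1) • !₂[Real.cos p.2, Real.sin p.2]

lemma measurable_displacement (t : ℝ) : Measurable (displacement t) := by
  have : Continuous (displacement t) := by
    unfold displacement
    refine (continuous_const.mul continuous_fst).smul ?_
    refine (PiLp.continuous_toLp 2 _).comp (continuous_pi fun i => ?_)
    fin_cases i
    · exact Real.continuous_cos.comp continuous_snd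
    · exact Real.continuous_sin.comp continuous_snd
  exact this.measurable

lemma exists_polar (y : Plane) :
    ∃ φ : ℝ, y 0 = ‖y‖ * Real.cos φ ∧ y 1 = ‖y‖ * Real.sin φ := by
  have h : ‖(⟨y 0, y 1⟩ : ℂ)‖ = ‖y‖ := by
    rw [EuclideanSpace.norm_eq, Complex.norm_eq_sqrt_sq_add_sq]
    simp [Fin.sum_univ_two]
  refine ⟨Complex.arg ⟨y 0, y 1⟩, ?_, ?_⟩
  · rw [← h, Complex.norm_mul_cos_arg]
  · rw [← h, Complex.norm_mul_sin_arg]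

/-- The law of cosines, for sides ‖y‖ and vt enclosing the angle θ - φ. -/
lemma norm_sub_displacement_sq {y : Plane} {φ : ℝ} (h0 : y 0 = ‖y‖ * Real.cos φ)
    (h1 : y 1 = ‖y‖ * Real.sin φ) (t v θ : ℝ) :
    ‖y - displacement t (v, θ)‖ ^ 2 =
      v ^ 2 * t ^ 2 + ‖y‖ ^ 2 - 2 * v * t * ‖y‖ * Real.cos (θ - φ) := by
  rw [EuclideanSpace.norm_sq_eq, Fin.sum_univ_two]
  simp only [displacement, PiLp.sub_apply, PiLp.smul_apply, Real.norm_eq_abs, sq_abs, smul_eq_mul]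
  simp only [Matrix.cons_val_zero, Matrix.cons_val_one]
  rw [h0, h1, Real.cos_sub]
  have e1 := Real.sin_sq_add_cos_sq φ
  have e2 := Real.sin_sq_add_cos_sq θ
  linear_combination ‖y‖ ^ 2 * e1 + t ^ 2 * v ^ 2 * e2

/-- The probability that a drone that is found at `y` at time `t`, with speed `v`, started at
distance more than `s` from the origin. -/
lemma cond_Ico_lt_norm_sub_displacement {y : Plane} (hy : y ≠ 0) {t v s : ℝ} (ht : 0 < t)
    (hv : 0 < v) (hs : 0 ≤ s) :
    ProbabilityTheory.cond volume (Ico 0 (2 * Real.pi)) {θ | s < ‖y - displacement t (v, θ)‖} =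
      ENNReal.ofReal (1 - Real.arccos ((v ^ 2 * t ^ 2 + ‖y‖ ^ 2 - s ^ 2) / (2 * v * t * ‖y‖)) /
        Real.pi) := by
  obtain ⟨φ, h0, h1⟩ := exists_polar y
  rw [← cond_Ico_cos_sub_lt φ]
  congr 1
  ext θ
  have hu : 0 < ‖y‖ := norm_pos_iff.2 hy
  have hpos : 0 < 2 * v * t * ‖y‖ := by positivity
  simp only [mem_ofPred_eq]
  rw [← sq_lt_sq₀ hs (norm_nonneg _), norm_sub_displacement_sq h0 h1, lt_div_iff₀ hpos]
  constructor <;> intro h <;> linarith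

/-- If vt ≤ s - u the ratio is at most -1 and arccos is π: no such drone came from beyond s. If vt >
s + u or vt ≤ u - s the ratio is at least 1 and arccos is 0. Only the remaining speeds need the
integral. -/
lemma one_sub_arccos_eq {t u s v : ℝ} (ht : 0 < t) (hu : 0 < u) (hs : 0 ≤ s) (hv : 0 < v) :
    1 - Real.arccos ((v ^ 2 * t ^ 2 + u ^ 2 - s ^ 2) / (2 * v * t * u)) / Real.pi =
      1 - (Iic ((s - u) / t)).indicator (fun _ => 1) v -
        (Ioc (|s - u| / t) ((s + u) / t)).indicator (fun v => 1 / Real.pi *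
          Real.arccos ((v ^ 2 * t ^ 2 + u ^ 2 - s ^ 2) / (2 * v * t * u))) v := by
  have hpos : 0 < 2 * v * t * u := by positivity
  have hvt : 0 < v * t := by positivity
  by_cases h1 : v ≤ (s - u) / t
  · have h1' : v * t ≤ s - u := (le_div_iff₀ ht).1 h1
    have hle : (s - u) / t ≤ |s - u| / t := by gcongr; exact le_abs_self _
    rw [indicator_of_mem (show v ∈ Iic _ from h1),
      indicator_of_notMem (fun h => (h1.trans hle).not_gt h.1), Real.arccos_of_le_neg_one]
    · rw [div_self Real.pi_ne_zero]; ring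
    · rw [div_le_iff₀ hpos]; nlinarith
  · have h1' : s - u < v * t := (div_lt_iff₀ ht).1 (not_le.1 h1)
    rw [indicator_of_notMem (show v ∉ Iic _ from h1)]
    by_cases h2 : v ∈ Ioc (|s - u| / t) ((s + u) / t)
    · rw [indicator_of_mem h2]; ring
    · rw [indicator_of_notMem h2, Real.arccos_of_one_le]
      · simp
      · rw [le_div_iff₀ hpos]
        by_cases h3 : v ≤ |s - u| / t
        · have h3' : v * t ≤ |s - u| := (le_div_iff₀ ht).1 h3
          rcases abs_cases (s - u) with ⟨h, _⟩ | ⟨h, _⟩ <;> rw [h] at h3'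
          · linarith
          · nlinarith
        · have h4 : (s + u) / t < v := by
            by_contra h4
            exact h2 ⟨not_le.1 h3, not_lt.1 h4⟩
          have h4' := (div_lt_iff₀ ht).1 h4
          nlinarith

/-- A speed with a pdf has no atom at 0, where the ratio in the arccos would divide by zero. -/
lemma ae_pos_of_withDensity {ν : Measure ℝ} {f : ℝ → ℝ} (hν : ν (Iio 0) = 0)
    (hνf : ν = volume.withDensity fun v => ENNReal.ofReal (f v)) : ∀ᵐ v ∂ν, 0 < v := by
  have h0 : ν {0} = 0 := by
    rw [hνf]
    exact withDensity_absolutelyContinuous _ _ (by simp)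
  rw [ae_iff]
  have : {v : ℝ | ¬ 0 < v} ⊆ Iio 0 ∪ {0} := fun v hv => by
    rcases lt_or_eq_of_le (not_lt.1 hv) with h | h
    · exact Or.inl h
    · exact Or.inr h
  exact measure_mono_null this (measure_union_null hν h0)

/-! ### The explicit density -/

section Density

variable {ν : Measure ℝ} [IsProbabilityMeasure ν] {f : ℝ → ℝ}

lemma measurable_arccos_ratio (t u s : ℝ) : Measurable fun v : ℝ =>
    Real.arccos ((v ^ 2 * t ^ 2 + u ^ 2 - s ^ 2) / (2 * v * t * u)) :=
  Real.continuous_arccos.measurable.comp (by fun_prop)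

lemma integrable_arccos_ratio (t u s : ℝ) : Integrable (fun v : ℝ =>
    Real.arccos ((v ^ 2 * t ^ 2 + u ^ 2 - s ^ 2) / (2 * v * t * u))) ν := by
  refine Integrable.of_bound (measurable_arccos_ratio t u s).aestronglyMeasurable Real.pi
    (ae_of_all _ fun v => ?_)
  rw [Real.norm_of_nonneg (Real.arccos_nonneg _)]
  exact Real.arccos_le_pi _

/-- The integral form of the density, by conditioning on the speed. -/
lemma density_eq_integral (hν : ν (Iio 0) = 0) (hf : Measurable f) (hf0 : ∀ v, 0 ≤ f v)
    (hνf : ν = volume.withDensity fun v => ENNReal.ofReal (f v)) (lam : ℝ) {t u s : ℝ}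
    (ht : 0 < t) (hu : 0 < u) (hs : 0 ≤ s) :
    density lam (cdf ν) f t u s = lam * ∫ v, (1 - Real.arccos
      ((v ^ 2 * t ^ 2 + u ^ 2 - s ^ 2) / (2 * v * t * u)) / Real.pi) ∂ν := by
  set h : ℝ → ℝ := fun v => 1 / Real.pi *
    Real.arccos ((v ^ 2 * t ^ 2 + u ^ 2 - s ^ 2) / (2 * v * t * u)) with hh
  have hint : Integrable h ν := (integrable_arccos_ratio t u s).const_mul _
  have hle : |s - u| / t ≤ (s + u) / t := by
    gcongr
    exact abs_le.2 ⟨by linarith, by linarith⟩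
  have h1 : ∫ v, (1 - Real.arccos
      ((v ^ 2 * t ^ 2 + u ^ 2 - s ^ 2) / (2 * v * t * u)) / Real.pi) ∂ν =
      ∫ v, (1 - (Iic ((s - u) / t)).indicator (fun _ => (1 : ℝ)) v -
        (Ioc (|s - u| / t) ((s + u) / t)).indicator h v) ∂ν := by
    refine integral_congr_ae ?_
    filter_upwards [ae_pos_of_withDensity hν hνf] with v hv
    exact one_sub_arccos_eq ht hu hs hv
  have hi1 : Integrable ((Iic ((s - u) / t)).indicator (fun _ => (1 : ℝ))) ν :=
    (integrable_const 1).indicator measurableSet_Iic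
  have hi3 : Integrable (fun v => 1 - (Iic ((s - u) / t)).indicator (fun _ => (1 : ℝ)) v) ν :=
    (integrable_const 1).sub hi1
  have hi2 : Integrable ((Ioc (|s - u| / t) ((s + u) / t)).indicator h) ν :=
    hint.indicator measurableSet_Ioc
  have h2 : ∫ v in Ioc (|s - u| / t) ((s + u) / t), h v ∂ν =
      ∫ v in (|s - u| / t)..((s + u) / t), f v * (1 / Real.pi) *
        Real.arccos ((v ^ 2 * t ^ 2 + u ^ 2 - s ^ 2) / (2 * v * t * u)) := by
    rw [intervalIntegral.integral_of_le hle, hνf,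
      setIntegral_withDensity_eq_setIntegral_toReal_smul (by fun_prop)
        (ae_of_all _ fun v => ENNReal.ofReal_lt_top) _ measurableSet_Ioc]
    refine integral_congr_ae (ae_of_all _ fun v => ?_)
    simp only [ENNReal.toReal_ofReal (hf0 v), smul_eq_mul, hh]
    ring
  rw [h1, integral_sub hi3 hi2, integral_sub (integrable_const 1) hi1,
    integral_indicator measurableSet_Ioc, integral_indicator measurableSet_Iic, h2, density,
    cdf_eq_real]
  simp

lemma one_sub_arccos_div_pi_nonneg (c : ℝ) : 0 ≤ 1 - Real.arccos c / Real.pi := by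
  rw [sub_nonneg, div_le_one Real.pi_pos]
  exact Real.arccos_le_pi c

lemma density_nonneg (hν : ν (Iio 0) = 0) (hf : Measurable f) (hf0 : ∀ v, 0 ≤ f v)
    (hνf : ν = volume.withDensity fun v => ENNReal.ofReal (f v)) {lam : ℝ} (hlam : 0 ≤ lam)
    {t u s : ℝ} (ht : 0 < t) (hu : 0 ≤ u) (hs : 0 ≤ s) : 0 ≤ density lam (cdf ν) f t u s := by
  -- At u = 0 the integral form is unavailable, but the interval of integration degenerates and λ₀(1
  -- - F(s/t)) remains.
  rcases hu.eq_or_lt with rfl | hu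
  · rw [density]
    simp only [sub_zero, add_zero, abs_of_nonneg hs, intervalIntegral.integral_same]
    exact mul_nonneg hlam (sub_nonneg.2 (cdf_le_one ν _))
  · rw [density_eq_integral hν hf hf0 hνf lam ht hu hs]
    exact mul_nonneg hlam (integral_nonneg fun v => one_sub_arccos_div_pi_nonneg _)

instance : IsProbabilityMeasure (ProbabilityTheory.cond (volume : Measure ℝ)
    (Ico 0 (2 * Real.pi))) :=
  cond_isProbabilityMeasure_of_finite (by simp [Real.pi_pos]) measure_Ico_lt_top.ne

/-- The law of the displacement during a time `t`. -/
def displacementLaw (ν : Measure ℝ) (t : ℝ) : Measure Plane :=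
  (ν.prod (ProbabilityTheory.cond volume (Ico 0 (2 * Real.pi)))).map (displacement t)

instance (t : ℝ) : IsProbabilityMeasure (displacementLaw ν t) :=
  Measure.isProbabilityMeasure_map (measurable_displacement t).aemeasurable

lemma displacementLaw_lt_norm_sub (hν : ν (Iio 0) = 0) (hf : Measurable f) (hf0 : ∀ v, 0 ≤ f v)
    (hνf : ν = volume.withDensity fun v => ENNReal.ofReal (f v)) {lam : ℝ} (hlam : 0 ≤ lam)
    {t s : ℝ} (ht : 0 < t) (hs : 0 ≤ s) {y : Plane} (hy : y ≠ 0) :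
    (lam.toNNReal : ℝ≥0∞) * displacementLaw ν t {d | s < ‖y - d‖} =
      ENNReal.ofReal (density lam (cdf ν) f t ‖y‖ s) := by
  have hmy : MeasurableSet {d : Plane | s < ‖y - d‖} :=
    measurableSet_lt measurable_const (measurable_id.const_sub y).norm
  have hnn : ∀ v : ℝ, 0 ≤ 1 - Real.arccos ((v ^ 2 * t ^ 2 + ‖y‖ ^ 2 - s ^ 2) /
      (2 * v * t * ‖y‖)) / Real.pi := fun v => one_sub_arccos_div_pi_nonneg _
  have hint : Integrable (fun v : ℝ => 1 - Real.arccos ((v ^ 2 * t ^ 2 + ‖y‖ ^ 2 - s ^ 2) /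
      (2 * v * t * ‖y‖)) / Real.pi) ν :=
    (integrable_const 1).sub ((integrable_arccos_ratio t ‖y‖ s).div_const _)
  rw [density_eq_integral hν hf hf0 hνf lam ht (norm_pos_iff.2 hy) hs, ENNReal.ofReal_mul hlam,
    ofReal_integral_eq_lintegral_ofReal hint (ae_of_all _ hnn),
    displacementLaw, Measure.map_apply (measurable_displacement t) hmy,
    Measure.prod_apply (measurable_displacement t hmy)]
  congr 1
  refine lintegral_congr_ae ?_
  filter_upwards [ae_pos_of_withDensity hν hνf] with v hv
  exact cond_Ico_lt_norm_sub_displacement hy ht hv hs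

lemma displacedIntensity_eq_radialMeasure (hν : ν (Iio 0) = 0) (hf : Measurable f)
    (hf0 : ∀ v, 0 ≤ f v) (hνf : ν = volume.withDensity fun v => ENNReal.ofReal (f v)) {lam : ℝ}
    (hlam : 0 ≤ lam) {t s : ℝ} (ht : 0 < t) (hs : 0 ≤ s) :
    displacedIntensity lam.toNNReal (displacementLaw ν t) s =
      radialMeasure fun u => density lam (cdf ν) f t u s := by
  rw [displacedIntensity_eq_withDensity, radialMeasure]
  refine withDensity_congr_ae ?_
  -- At the origin the ratio divides by zero, but a single point does not affect the density.
  have h0 : ∀ᵐ y : Plane, y ≠ 0 := by simp [ae_iff]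
  filter_upwards [h0] with y hy
  exact displacementLaw_lt_norm_sub hν hf hf0 hνf hlam ht hs hy

/-- At time 0 the displacement law is the Dirac mass at 0, so the initial process is a case of the
displacement theorem. -/
lemma displacedIntensity_zero_eq_radialMeasure (lam s : ℝ) :
    displacedIntensity lam.toNNReal (displacementLaw ν 0) s =
      radialMeasure fun u => initialDensity lam u s := by
  have h0 : displacementLaw ν 0 = Measure.dirac 0 := by
    have : displacement 0 = fun _ => 0 := by ext1 p; simp [displacement]
    rw [displacementLaw, this, Measure.map_const, measure_univ, one_smul]
  have h1 : (fun y : Plane => ENNReal.ofReal (initialDensity lam ‖y‖ s)) =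
      (outside s).indicator fun _ => (lam.toNNReal : ℝ≥0∞) := by
    ext y
    by_cases hy : y ∈ outside s
    · rw [indicator_of_mem hy, initialDensity, if_pos (show s < ‖y‖ from hy)]; rfl
    · rw [indicator_of_notMem hy, initialDensity, if_neg (show ¬ s < ‖y‖ from hy),
        ENNReal.ofReal_zero]
  rw [displacedIntensity, h0, Measure.conv_dirac_zero, radialMeasure, h1,
    withDensity_indicator (measurableSet_outside s), withDensity_const, Measure.restrict_smul]

end Density

/-! ### Assembly -/

/-- The explicit density is identified only for r ≥ 0, which holds almost everywhere for the law of
the serving distance. -/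
lemma IsPoissonProcessGiven.congr_intensity {Ω E : Type*} [MeasurableSpace Ω]
    [PseudoMetricSpace E] [MeasurableSpace E] {P : Measure Ω} {N : Ω → Measure E} {R : Ω → ℝ}
    {Λ Λ' : ℝ → Measure E} (h : IsPoissonProcessGiven P N R Λ)
    (hΛ : ∀ᵐ r ∂(P.map R), Λ r = Λ' r) : IsPoissonProcessGiven P N R Λ' where
  measurable_given := h.measurable_given
  measurable_count := h.measurable_count
  finite_of_bounded := by
    filter_upwards [h.finite_of_bounded, hΛ] with r hr he
    rwa [← he]
  law_counts k B hB hb hd n A hA := by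
    rw [h.law_counts k B hB hb hd n A hA]
    refine lintegral_congr_ae (ae_restrict_of_ae ?_)
    filter_upwards [hΛ] with r he
    rw [he]

/-- The non-serving drones of the different speed model form, at any time, a Poisson process
conditionally on the serving distance. -/
theorem IsDSM.isPoissonProcessGiven {Ω : Type*} [MeasurableSpace Ω] {P : Measure Ω}
    [IsProbabilityMeasure P] {lam : ℝ} {ν : Measure ℝ} [IsProbabilityMeasure ν]
    {X : ℕ → Ω → Plane} {V Θ : ℕ → Ω → ℝ} (hD : IsDSM P lam ν X V Θ) (t : ℝ) :
    IsPoissonProcessGiven P (nonServingProcess X V Θ t) (servingDistance X)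
      (displacedIntensity lam.toNNReal (displacementLaw ν t)) := by
  have hmark : ∀ i, Measurable fun ω => (V i ω, Θ i ω) := fun i =>
    (hD.measurable_speed i).prodMk (hD.measurable_direction i)
  refine isPoissonProcessGiven_displaced (D := fun i ω => displacement t (V i ω, Θ i ω))
    hD.measurable_start (fun i => (measurable_displacement t).comp (hmark i)) (fun i => ?_)
    (hD.indep_drones.comp (fun _ => displacement t) fun _ => measurable_displacement t)
    (hD.indep_start.comp (φ := id)
      (ψ := fun (z : ℕ → ℝ × ℝ) i => displacement t (z i)) measurable_id
      (measurable_pi_lambda _ fun i => (measurable_displacement t).comp (measurable_pi_apply i)))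
    hD.poisson_start
  have h1 := (indepFun_iff_map_prod_eq_prod_map_map (hD.measurable_speed i).aemeasurable
    (hD.measurable_direction i).aemeasurable).1 (hD.indep_speed_direction i)
  have h2 : P.map (Θ i) = ProbabilityTheory.cond volume (Ico 0 (2 * Real.pi)) :=
    hD.law_direction i
  rw [hD.law_speed, h2] at h1
  rw [displacementLaw, ← h1, Measure.map_map (measurable_displacement t) (hmark i)]
  rfl

end DroneNetwork

end

theorem lemma3 {Ω : Type*} [MeasurableSpace Ω] (P : Measure Ω) [IsProbabilityMeasure P]
    (lam : ℝ) (hlam : 0 < lam)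
    (ν : Measure ℝ) [IsProbabilityMeasure ν] (hν : ν (Iio 0) = 0)
    (f : ℝ → ℝ) (hf : Measurable f) (hf0 : ∀ v, 0 ≤ f v)
    (hνf : ν = volume.withDensity fun v => ENNReal.ofReal (f v))
    (X : ℕ → Ω → Plane) (V Θ : ℕ → Ω → ℝ) (hD : IsDSM P lam ν X V Θ) :
    IsPoissonProcessGiven P (nonServingProcess X V Θ 0) (servingDistance X)
        (fun s => radialMeasure fun u => initialDensity lam u s) ∧
      ∀ t : ℝ, 0 < t →
        (∀ u s : ℝ, 0 ≤ u → 0 ≤ s → 0 ≤ density lam (cdf ν) f t u s) ∧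
        IsPoissonProcessGiven P (nonServingProcess X V Θ t) (servingDistance X)
          (fun s => radialMeasure fun u => density lam (cdf ν) f t u s) := by
  have hR := measurable_servingDistance hD.measurable_start
  have hpos : ∀ᵐ r ∂(P.map (servingDistance X)), 0 ≤ r :=
    (ae_map_iff hR.aemeasurable measurableSet_Ici).2 (ae_of_all _ servingDistance_nonneg)
  refine ⟨(hD.isPoissonProcessGiven 0).congr_intensity
    (ae_of_all _ (displacedIntensity_zero_eq_radialMeasure lam)), fun t ht =>
    ⟨fun u s hu hs => density_nonneg hν hf hf0 hνf hlam.le ht hu hs,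
      (hD.isPoissonProcessGiven t).congr_intensity ?_⟩⟩
  filter_upwards [hpos] with s hs
  exact displacedIntensity_eq_radialMeasure hν hf hf0 hνf hlam.le ht hs
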